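/- Let $A$ be a Noetherian local ring with maximal ideal $\mathfrak m$ and $d=\dim A$. For a finitely generated $A$-module $M$ put $$\mathfrak a_A(M)=\prod_{p=0}^{\dim M-1}\operatorname{ann}_A H^p_{\mathfrak m}(M),\qquad H^p_{\mathfrak m}(M)=\varinjlim_m \operatorname{Ext}_A^p(A/\mathfrak m^m,M).$$ A sequence $f_1,\dots,f_h$ of elements of $A$ is called a d-sequence on an $A$-module $M$ if $$(f_1,\dots,f_{i-1})M :_M f_if_j=(f_1,\dots,f_{i-1})M :_M f_j\qquad\text{for all } 1\le i\le j\le h.$$ Let $0\le s\le d$ be an integer and let $x_1,\dots,x_d$ be a system of parameters for $A$ such that $$x_{s+1},\dots,x_d\in\mathfrak a_A(A)\qquad\text{and}\qquad x_i\in\mathfrak a_A\bigl(A/(x_{i+1},\dots,x_d)\bigr)\ \text{ for all } 1\le i\le s.$$ Put $\mathfrak q=(x_{s+1},\dots,x_d)$. Then: (1) for all positive integers $n_1,\dots,n_d$ and every permutation $\sigma$ of $\{s+1,\dots,d\}$, the sequence $x_1^{n_1},\dots,x_s^{n_s},x_{\sigma(s+1)}^{n_{s+1}},\dots,x_{\sigma(d)}^{n_d}$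 is a d-sequence on $A$; (2) if $s>0$, then for all positive integers $n_1,\dots,n_s$ and $n$, the sequence $x_1^{n_1},\dots,x_s^{n_s}$ is a d-sequence on $A/\mathfrak q^n$. -/

import Mathlib

noncomputable section

universe u

namespace Macaulayfication

/-- The sequence `f` (of length `h`, indexed from `0`) is a d-sequence on the `A`-module `M`:
`(f_1, …, f_{i-1})M : f_i f_j = (f_1, …, f_{i-1})M : f_j` for all `i ≤ j`. Here, for a submodule
`N` of `M` and `a` in `A`, the colon submodule `N : a = {m ∈ M | a m ∈ N}` is
`N.comap (LinearMap.lsmul A M a)`. -/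
def IsDSequence {A : Type*} [CommRing A] (M : Type*) [AddCommGroup M] [Module A M]
    {h : ℕ} (f : Fin h → A) : Prop :=
  ∀ i j : Fin h, i ≤ j →
    (Ideal.span (f '' {k | k < i}) • (⊤ : Submodule A M)).comap
        (LinearMap.lsmul A M (f i * f j)) =
      (Ideal.span (f '' {k | k < i}) • (⊤ : Submodule A M)).comap
        (LinearMap.lsmul A M (f j))

/-- `x_1, …, x_d` is a system of parameters for the Noetherian local ring `A`: `d = dim A` and
the ideal `(x_1, …, x_d)` is primary to the maximal ideal. -/
def IsSystemOfParameters {A : Type*} [CommRing A] [IsLocalRing A] {d : ℕ} (x : Fin d → A) :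
    Prop :=
  ringKrullDim A = d ∧ (Ideal.span (Set.range x)).radical = IsLocalRing.maximalIdeal A

/-- The dimension of a module (the Krull dimension of its support) as a natural number. It is
the true dimension whenever `M` is a nonzero finitely generated module over a Noetherian local
ring, and `0` if `M` is zero. -/
def moduleDim (A : Type*) [CommRing A] (M : Type*) [AddCommGroup M] [Module A M] : ℕ :=
  ((Module.supportDim A M).unbotD 0).toNat

/-- The ideal `𝔞_A(M)`, the product of the annihilators of the local cohomology modules
`H_𝔪^p(M)` over `0 ≤ p < dim M`. -/
def cohomologyAnnihilator (A : Type u) [CommRing A] [IsLocalRing A]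
    (M : Type u) [AddCommGroup M] [Module A M] : Ideal A :=
  ∏ p ∈ Finset.range (moduleDim A M),
    Module.annihilator A
      ((localCohomology (IsLocalRing.maximalIdeal A) p).obj (ModuleCat.of A M))

/-- The sequence `x_1, …, x_d` satisfies `x_{s+1}, …, x_d ∈ 𝔞_A(A)` and
`x_i ∈ 𝔞_A(A / (x_{i+1}, …, x_d))` for `i ≤ s`. With indices starting from `0`, the elements
`x_1, …, x_s` are those of index `i < s`. -/
def IsAdapted {A : Type u} [CommRing A] [IsLocalRing A] (s : ℕ) {d : ℕ} (x : Fin d → A) :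
    Prop :=
  (∀ i : Fin d, s ≤ (i : ℕ) → x i ∈ cohomologyAnnihilator A A) ∧
    ∀ i : Fin d, (i : ℕ) < s →
      x i ∈ cohomologyAnnihilator A (A ⧸ Ideal.span (x '' {k | i < k}))

end Macaulayfication

end

/-!
The key fact is due to Schenzel: an element of `cohomologyAnnihilator A M` maps the colon module
`QM : y` into `QM` whenever `Q` is generated by part of a system of parameters of `M` and `y` is a
further member of it (`smul_mem_of_mem_cohomologyAnnihilator`). It is proved with the Koszul complex
of the generators of `Q`. Its homology is killed by an ideal that, together with `y`, is primary to
the maximal ideal, so it has no local cohomology in degrees at least `2`. The short exact sequences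
of cycles and boundaries then show that products of annihilators of the `H^p(M)` annihilate the
`H^0` of the zeroth homology `M ⧸ QM`, and `(QM : y) ⧸ QM` is contained in this `H^0`. By Krull's
intersection theorem one may pass from systems of generators of maximal length to shorter ones.

Let `Q` be generated by powers of some of the `x i`. For `k ≥ s` the key fact for `M = A` says that
`x k` maps `Q : x u ^ e x k ^ f` into `Q`. For `k < s` it says the same modulo the parameters of
index greater than `k`. These can be removed one after another, from the top, by descending
induction on `k` (`ColonStable`, `IsAdapted.colonStable`), if the indices that occur in `Q` are less
than `k`. This is a form of the d-sequence property of all the sequences of powers. The same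
induction also works modulo the ideal `𝔮` generated by the `x i` with `i ≥ s`.

For the quotients by powers of `𝔮`, the elements `x i` with `i ≥ s` are a d-sequence modulo
`Q + (x u ^ e)` for `u < s`. With Huneke's description of the powers of an ideal generated by a
d-sequence, this gives `(Q + 𝔮 ^ (n+1)) : x u ^ e ⊆ 𝔮 ^ n ((Q + 𝔮) : x u ^ e) + (Q : x u ^ e)`
(`mem_of_mul_mem_sup_pow`). Multiplication by `x k` sends the two terms on the right to
`𝔮 ^ (n+1) + Q` and `Q` by the previous paragraph. Applied first to `x u` and then to `x k`, this
shows that `x u ^ e x k ^ f c ∈ Q + 𝔮 ^ (n+1)` implies `x k c ∈ Q + 𝔮 ^ (n+1)`.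
-/

/-! ### Local cohomology in terms of `Abelian.Ext` -/

section

open CategoryTheory Limits Opposite Abelian

lemma HomologicalComplex.homologyUnop_hom_naturality {V ι : Type*} [Category* V] [Abelian V]
    {c : ComplexShape ι} {K L : HomologicalComplex Vᵒᵖ c} (f : K ⟶ L) (i : ι) :
    homologyMap ((unopFunctor _ _).map f.op) i ≫ (K.homologyUnop i).hom =
      (L.homologyUnop i).hom ≫ (homologyMap f i).unop :=
  Quiver.Hom.op_inj (homologyOp_hom_naturality ((unopFunctor _ _).map f.op) i).symm

namespace CategoryTheory.ProjectiveResolution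

variable {R : Type*} [Ring R] {C : Type*} [Category* C] [Abelian C] [Linear R C]
  [EnoughProjectives C]

variable (R) in
/-- The morphism of cochain complexes `Hom(X, Y) ⟶ Hom(X', Y)` given by precomposition with a
morphism of chain complexes `X' ⟶ X`. -/
noncomputable def linearYonedaObjMap {X' X : ChainComplex C ℕ} (φ : X' ⟶ X) (Y : C) :
   X.linearYonedaObj R Y ⟶ X'.linearYonedaObj R Y :=
  (HomologicalComplex.unopFunctor _ _).map
    ((((linearYoneda R C).obj Y).rightOp.mapHomologicalComplex _).map φ).op

/-- The computation of `Ext R C n`, defined as a left derived functor, by a projective resolution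
is natural in the first variable. -/
lemma isoExt_hom_naturality {X' X : C} {g : X' ⟶ X} {P' : ProjectiveResolution X'}
    {P : ProjectiveResolution X} (φ : Hom P' P g) (n : ℕ) (Y : C) :
    (P.isoExt n Y).inv ≫ ((Ext R C n).map g.op).app Y =
      HomologicalComplex.homologyMap (linearYonedaObjMap R φ.hom Y) n ≫
        (P'.isoExt (R := R) n Y).inv := by
  let F : C ⥤ (ModuleCat R)ᵒᵖ := ((linearYoneda R C).obj Y).rightOp
  let ψ := (F.mapHomologicalComplex _).map φ.hom
  have h1 := isoLeftDerivedObj_hom_naturality g P' P φ.hom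
    (by simpa using φ.hom_f_zero_comp_π_f_zero) F n
  have h2 := HomologicalComplex.homologyUnop_hom_naturality ψ n
  have h1' : (P.isoLeftDerivedObj F n).hom.unop ≫ ((Ext R C n).map g.op).app Y =
      (HomologicalComplex.homologyMap ψ n).unop ≫ (P'.isoLeftDerivedObj F n).hom.unop :=
    congrArg Quiver.Hom.unop h1
  exact (Category.assoc _ _ _).trans ((congrArg (_ ≫ ·) h1').trans
    ((Category.assoc _ _ _).symm.trans
      ((congrArg (· ≫ _) h2.symm).trans (Category.assoc _ _ _))))

end CategoryTheory.ProjectiveResolution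

namespace Macaulayfication

variable {A : Type u} [CommRing A] {X X' : ModuleCat.{u} A} {P : ProjectiveResolution X}
  {P' : ProjectiveResolution X'} {Y : ModuleCat.{u} A} {n : ℕ}

variable (P Y n) in
/-- The element `e` of `Ext^n(X, Y)`, in the sense of the left derived functor `Ext`, is the class
of the `n`-cocycle `f` of the complex `Hom(P, Y)`. -/
def Represents (e : ((Ext A (ModuleCat.{u} A) n).obj (op X)).obj Y) (f : P.complex.X n ⟶ Y) :
    Prop :=
  ∃ c : (P.complex.linearYonedaObj A Y).cycles n,
    (P.complex.linearYonedaObj A Y).iCycles n c = f ∧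
      (P.isoExt n Y).inv ((P.complex.linearYonedaObj A Y).homologyπ n c) = e

lemma exists_represents (f : P.complex.X n ⟶ Y) (hf : P.complex.d (n + 1) n ≫ f = 0) :
    ∃ e, Represents P Y n e f :=
  ⟨_, (P.complex.linearYonedaObj A Y).cyclesMk f (n + 1) (by simp) hf,
    (P.complex.linearYonedaObj A Y).i_cyclesMk f (n + 1) _ _, rfl⟩

lemma Represents.smul {e} {f : P.complex.X n ⟶ Y} (h : Represents P Y n e f) (a : A) :
    Represents P Y n (a • e) (a • f) := by
  obtain ⟨c, h1, h2⟩ := h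
  exact ⟨a • c, by rw [map_smul, h1]; rfl, by rw [map_smul, map_smul, h2]⟩

lemma Represents.comp {e} {f : P.complex.X n ⟶ Y} (h : Represents P Y n e f) {g : X' ⟶ X}
    (φ : P'.Hom P g) :
    Represents P' Y n (((Ext A (ModuleCat A) n).map g.op).app Y e) (φ.hom.f n ≫ f) := by
  obtain ⟨c, h1, h2⟩ := h
  let ψ := ProjectiveResolution.linearYonedaObjMap A φ.hom Y
  refine ⟨HomologicalComplex.cyclesMap ψ n c, ?_, ?_⟩
  · have := congr($(HomologicalComplex.cyclesMap_i ψ n) c)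
    simp only [ModuleCat.comp_apply] at this
    rw [this, h1]
    rfl
  · have := congr($(HomologicalComplex.homologyπ_naturality ψ n) c)
    simp only [ModuleCat.comp_apply] at this
    rw [← this, ← ModuleCat.comp_apply, ← ProjectiveResolution.isoExt_hom_naturality,
      ModuleCat.comp_apply, h2]

/-- A cocycle whose class vanishes in the left derived functor `Ext` has zero class in the group
`Abelian.Ext` of morphisms in the derived category. -/
lemma Represents.extMk_eq_zero {f : P.complex.X n ⟶ Y} (h : Represents P Y n 0 f)
    (hf : P.complex.d (n + 1) n ≫ f = 0) : P.extMk f (n + 1) rfl hf = 0 := by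
  obtain ⟨c, h1, h2⟩ := h
  let K := P.complex.linearYonedaObj A Y
  have h3 : K.homologyπ n c = 0 := by
    have := congr((P.isoExt n Y).hom $h2)
    simpa using this
  have hex := (ShortComplex.mk _ _
    (K.toCycles_comp_homologyπ ((ComplexShape.up ℕ).prev n) n)).exact_of_g_is_cokernel
      (K.homologyIsCokernel ((ComplexShape.up ℕ).prev n) n rfl)
  rw [ShortComplex.moduleCat_exact_iff] at hex
  obtain ⟨b, hb⟩ := hex c h3
  have h4 : ∃ (i : ℕ) (_ : i = (ComplexShape.up ℕ).prev n) (b : K.X i), K.d i n b = f := by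
    refine ⟨_, rfl, b, ?_⟩
    rw [← h1, ← hb, ← HomologicalComplex.toCycles_i]
    rfl
  obtain ⟨i, hi, b', h4⟩ := h4
  cases n with
  | zero =>
    have : f = 0 := by
      rw [← h4, HomologicalComplex.shape _ _ _ (by simp)]
      rfl
    subst this
    exact P.extMk_zero _ _
  | succ p =>
    rw [CochainComplex.prev_nat_succ] at hi
    subst hi
    rw [P.extMk_eq_zero_iff _ _ _ _ i rfl]
    exact ⟨b', h4⟩

/-- The projection `A ⧸ I ^ t ⟶ A ⧸ I ^ s` for `s ≤ t`. -/
noncomputable def quotPowMap (I : Ideal A) {s t : ℕ} (h : s ≤ t) :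
    ModuleCat.of A (A ⧸ I ^ t) ⟶ ModuleCat.of A (A ⧸ I ^ s) :=
  ModuleCat.ofHom (Submodule.mapQ _ _ LinearMap.id (Ideal.pow_le_pow_right h))

/-- Multiplication by `a` is zero on the ind-object `Ext^p(A ⧸ I ^ s, M)`, `s = 0, 1, …`: each
class on `A ⧸ I ^ s` is killed by `a` after restriction to some `A ⧸ I ^ t`. It says that
`a` annihilates the local cohomology module `H_I^p(M)`, but it is stated in terms of `Abelian.Ext`,
for which long exact sequences are available. -/
def AnnihilatesLocalCohomology (I : Ideal A) (a : A) (M : ModuleCat.{u} A) (p : ℕ) : Prop :=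
  ∀ (s : ℕ) (ξ : Abelian.Ext (ModuleCat.of A (A ⧸ I ^ s)) M p), ∃ (t : ℕ) (h : s ≤ t),
    a • (Abelian.Ext.mk₀ (quotPowMap I h)).comp ξ (zero_add p) = 0

theorem AnnihilatesLocalCohomology.of_mem_annihilator {I : Ideal A} {a : A} {M : ModuleCat.{u} A}
    {p : ℕ} (ha : a ∈ Module.annihilator A ((localCohomology I p).obj M)) :
    AnnihilatesLocalCohomology I a M p := by
  intro s ξ
  let D := localCohomology.diagram (localCohomology.idealPowersDiagram I) p
  let c : Cocone (D ⋙ (evaluation _ _).obj M) :=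
    ((evaluation _ _).obj M).mapCocone (colimit.cocone D)
  have hc : IsColimit c := isColimitOfPreserves _ (colimit.isColimit D)
  let P (t : ℕ) : ProjectiveResolution (ModuleCat.of A (A ⧸ I ^ t)) := projectiveResolution _
  obtain ⟨f, hf, rfl⟩ := (P s).extMk_surjective ξ (p + 1) rfl
  obtain ⟨e, he⟩ := exists_represents (P := P s) f hf
  let e' : (D ⋙ (evaluation _ _).obj M).obj (op (op s)) := e
  have h0 : c.ι.app (op (op s)) (a • e') = c.ι.app (op (op s)) 0 := by
    rw [map_smul, map_zero]
    exact Module.mem_annihilator.mp ha _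
  have : PreservesFilteredColimitsOfSize.{0, 0} (forget (ModuleCat.{u} A)) :=
    preservesFilteredColimitsOfSize_shrink.{0, u, 0, u} _
  -- An element of a filtered colimit is zero exactly when it dies at a finite stage.
  obtain ⟨⟨⟨t⟩⟩, g, hg⟩ := (hc.eq_iff' _ _).mp h0
  have hst : s ≤ t := g.unop.unop.le
  refine ⟨t, hst, ?_⟩
  let φ : (P t).Hom (P s) (quotPowMap I hst) :=
    ⟨ProjectiveResolution.lift (quotPowMap I hst) (P t) (P s),
      by simpa using! ProjectiveResolution.lift_commutes_zero (quotPowMap I hst) (P t) (P s)⟩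
  rw [← Abelian.Ext.comp_smul]
  have h1 := (he.smul a).comp φ
  have h2 : a • (P s).extMk f (p + 1) rfl hf = (P s).extMk (a • f) (p + 1) rfl (by simp [hf]) := by
    rw [Abelian.Ext.smul_eq_comp_mk₀, ProjectiveResolution.extMk_comp_mk₀]
    congr 1
  rw [h2, ProjectiveResolution.mk₀_comp_extMk _ _ _ _ φ]
  apply Represents.extMk_eq_zero
  convert h1 using 1
  rw [map_zero] at hg
  exact hg.symm

end Macaulayfication

end

/-! ### Annihilators of local cohomology in exact sequences -/

section

open CategoryTheory Limits Opposite Abelian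

namespace Macaulayfication

variable {A : Type u} [CommRing A] {I : Ideal A}

lemma quotPowMap_comp {s t r : ℕ} (h : s ≤ t) (h' : t ≤ r) :
    quotPowMap I h' ≫ quotPowMap I h = quotPowMap I (h.trans h') := by
  refine ModuleCat.hom_ext (LinearMap.ext fun x => ?_)
  obtain ⟨x, rfl⟩ := Submodule.Quotient.mk_surjective _ x
  rfl

namespace AnnihilatesLocalCohomology

variable {M N : ModuleCat.{u} A} {a b : A} {p : ℕ}

lemma of_subsingleton [Subsingleton M] : AnnihilatesLocalCohomology I a M p := by
  intro s ξ
  have : ξ = 0 := by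
    rw [← ξ.comp_mk₀_id, (ModuleCat.isZero_of_subsingleton M).eq_of_src (𝟙 M) 0, Ext.mk₀_zero,
      Ext.comp_zero]
  exact ⟨s, le_rfl, by simp [this]⟩

lemma of_retract (f : M ⟶ N) (g : N ⟶ M) (hfg : f ≫ g = 𝟙 M)
    (h : AnnihilatesLocalCohomology I a N p) : AnnihilatesLocalCohomology I a M p := by
  intro s ξ
  obtain ⟨t, hst, h0⟩ := h s (ξ.comp (Ext.mk₀ f) (add_zero p))
  refine ⟨t, hst, ?_⟩
  have := congr(($h0).comp (Ext.mk₀ g) (add_zero p))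
  simpa [hfg] using this

/-- Annihilators of local cohomology along a short exact sequence `0 → X₁ → X₂ → X₃ → 0`, for the
third term. -/
lemma third {S : ShortComplex (ModuleCat.{u} A)} (hS : S.ShortExact)
    (ha : AnnihilatesLocalCohomology I a S.X₂ p)
    (hb : AnnihilatesLocalCohomology I b S.X₁ (p + 1)) :
    AnnihilatesLocalCohomology I (a * b) S.X₃ p := by
  intro s ξ
  obtain ⟨t, hst, h0⟩ := hb s (ξ.comp hS.extClass rfl)
  obtain ⟨η, hη⟩ := Ext.covariant_sequence_exact₃ _ hS
    (b • (Ext.mk₀ (quotPowMap I hst)).comp ξ (zero_add p)) rfl (by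
      rw [Ext.smul_comp, Ext.comp_assoc _ _ _ _ rfl (by lia), h0])
  obtain ⟨r, htr, h1⟩ := ha t η
  refine ⟨r, hst.trans htr, ?_⟩
  have := congr(($h1).comp (Ext.mk₀ S.g) (add_zero p))
  simpa [hη, mul_smul, quotPowMap_comp] using this

/-- Annihilators of local cohomology along a short exact sequence, for the middle term. -/
lemma second {S : ShortComplex (ModuleCat.{u} A)} (hS : S.ShortExact)
    (ha : AnnihilatesLocalCohomology I a S.X₁ p)
    (hb : AnnihilatesLocalCohomology I b S.X₃ p) :
    AnnihilatesLocalCohomology I (a * b) S.X₂ p := by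
  intro s ξ
  obtain ⟨t, hst, h0⟩ := hb s (ξ.comp (Ext.mk₀ S.g) (add_zero p))
  obtain ⟨η, hη⟩ := Ext.covariant_sequence_exact₂ _ hS
    (b • (Ext.mk₀ (quotPowMap I hst)).comp ξ (zero_add p)) (by simpa using h0)
  obtain ⟨r, htr, h1⟩ := ha t η
  refine ⟨r, hst.trans htr, ?_⟩
  have := congr(($h1).comp (Ext.mk₀ S.f) (add_zero p))
  simpa [hη, mul_smul, quotPowMap_comp] using this

/-- Annihilators of local cohomology along a short exact sequence, for the first term. -/
lemma first {S : ShortComplex (ModuleCat.{u} A)} (hS : S.ShortExact)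
    (ha : AnnihilatesLocalCohomology I a S.X₃ p)
    (hb : AnnihilatesLocalCohomology I b S.X₂ (p + 1)) :
    AnnihilatesLocalCohomology I (a * b) S.X₁ (p + 1) := by
  intro s ξ
  obtain ⟨t, hst, h0⟩ := hb s (ξ.comp (Ext.mk₀ S.f) (add_zero _))
  obtain ⟨η, hη⟩ := Ext.covariant_sequence_exact₁ _ hS
    (b • (Ext.mk₀ (quotPowMap I hst)).comp ξ (zero_add _)) (by simpa using h0) rfl
  obtain ⟨r, htr, h1⟩ := ha t η
  refine ⟨r, hst.trans htr, ?_⟩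
  have := congr(($h1).comp hS.extClass rfl)
  rw [Ext.smul_comp, Ext.comp_assoc _ _ _ _ rfl (by lia), hη] at this
  simpa [mul_smul, quotPowMap_comp] using this

lemma prod (hM : AnnihilatesLocalCohomology I a M p) (hN : AnnihilatesLocalCohomology I a N p) :
    AnnihilatesLocalCohomology I a (ModuleCat.of A (M × N)) p := by
  intro s ξ
  let f₁ : ModuleCat.of A (M × N) ⟶ M := ModuleCat.ofHom (LinearMap.fst A M N)
  let f₂ : ModuleCat.of A (M × N) ⟶ N := ModuleCat.ofHom (LinearMap.snd A M N)
  let g₁ : M ⟶ ModuleCat.of A (M × N) := ModuleCat.ofHom (LinearMap.inl A M N)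
  let g₂ : N ⟶ ModuleCat.of A (M × N) := ModuleCat.ofHom (LinearMap.inr A M N)
  have hid : f₁ ≫ g₁ + f₂ ≫ g₂ = 𝟙 _ := by
    ext x <;> simp [f₁, f₂, g₁, g₂]
  obtain ⟨t₁, h₁, e₁⟩ := hM s (ξ.comp (Ext.mk₀ f₁) (add_zero p))
  obtain ⟨t₂, h₂, e₂⟩ := hN s (ξ.comp (Ext.mk₀ f₂) (add_zero p))
  refine ⟨max t₁ t₂, h₁.trans (le_max_left _ _), ?_⟩
  have e₁' := congr((Ext.mk₀ (quotPowMap I (le_max_left t₁ t₂))).comp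
    (($e₁).comp (Ext.mk₀ g₁) (add_zero p)) (zero_add p))
  have e₂' := congr((Ext.mk₀ (quotPowMap I (le_max_right t₁ t₂))).comp
    (($e₂).comp (Ext.mk₀ g₂) (add_zero p)) (zero_add p))
  have := congr($e₁' + $e₂')
  simp only [Ext.smul_comp, Ext.comp_smul, Ext.comp_assoc_of_third_deg_zero, Ext.mk₀_comp_mk₀,
    Ext.mk₀_comp_mk₀_assoc, quotPowMap_comp, ← smul_add, ← Ext.comp_add, ← Ext.mk₀_add, hid,
    Ext.comp_mk₀_id, Ext.zero_comp, Ext.comp_zero, add_zero] at this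
  exact this

/-- If some `z ∈ I` acts bijectively on `M`, then already `Ext^p(A ⧸ I ^ s, M) = 0`: it is killed
by `z ^ s`, which acts bijectively on it. -/
lemma of_bijective_smul {z : A} (hz : z ∈ I) (h : IsUnit (algebraMap A (Module.End A M) z)) :
    AnnihilatesLocalCohomology I a M p := by
  intro s ξ
  suffices ξ = 0 from ⟨s, le_rfl, by simp [this]⟩
  have h0 : z ^ s • ξ = 0 := by
    have : (Ext.mk₀ (z ^ s • 𝟙 (ModuleCat.of A (A ⧸ I ^ s)))).comp ξ (zero_add p) = z ^ s • ξ := by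
      rw [Ext.mk₀_smul, Ext.smul_comp, Ext.mk₀_id_comp]
    rw [← this]
    have : z ^ s • 𝟙 (ModuleCat.of A (A ⧸ I ^ s)) = 0 := by
      refine ModuleCat.hom_ext (LinearMap.ext fun x => ?_)
      obtain ⟨x, rfl⟩ := Submodule.Quotient.mk_surjective _ x
      exact (Submodule.Quotient.mk_eq_zero _).mpr (Ideal.mul_mem_right _ _ (Ideal.pow_mem_pow hz s))
    rw [this, Ext.mk₀_zero, Ext.zero_comp]
  obtain ⟨w, hw⟩ := h.pow s
  have h1 : (z ^ s • 𝟙 M) ≫ ModuleCat.ofHom (↑w⁻¹ : Module.End A M) = 𝟙 M := by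
    ext x
    have : (↑w⁻¹ : Module.End A M) (algebraMap A (Module.End A M) (z ^ s) x) = x := by
      rw [map_pow, ← hw]
      exact congr($(w.inv_mul) x)
    exact this
  have := congr(($h0).comp (Ext.mk₀ (ModuleCat.ofHom (↑w⁻¹ : Module.End A M))) (add_zero p))
  rwa [Ext.smul_eq_comp_mk₀, Ext.comp_assoc_of_third_deg_zero, Ext.mk₀_comp_mk₀, h1,
    Ext.comp_mk₀_id, Ext.zero_comp] at this

end AnnihilatesLocalCohomology

end Macaulayfication

end

/-! ### Vanishing of local cohomology -/

section

open CategoryTheory Limits Opposite Abelian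

namespace Macaulayfication

variable {A : Type u} [CommRing A] {I : Ideal A}

/-- Every element of `M` is killed by a power of the ideal `I`. -/
def IsPowTorsion (I : Ideal A) (M : Type*) [AddCommGroup M] [Module A M] : Prop :=
  ∀ m : M, ∃ k : ℕ, ∀ r ∈ I ^ k, r • m = 0

lemma IsPowTorsion.exists_pow_smul_le_ker {L N : Type*} [AddCommGroup L] [Module A L]
    [Module.Finite A L] [AddCommGroup N] [Module A N] (hN : IsPowTorsion I N) (φ : L →ₗ[A] N) :
    ∃ s : ℕ, I ^ s • (⊤ : Submodule A L) ≤ LinearMap.ker φ := by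
  obtain ⟨S, hS⟩ := Module.Finite.fg_top (R := A) (M := L)
  choose k hk using fun x => hN (φ x)
  refine ⟨S.sup k, ?_⟩
  rw [← hS, Submodule.smul_le]
  intro r hr x hx
  refine Submodule.span_induction (fun y hy => ?_) (by simp) (fun y z _ _ hy hz => ?_)
    (fun a y _ hy => ?_) hx
  · rw [LinearMap.mem_ker, map_smul]
    exact hk y r (Ideal.pow_le_pow_right (Finset.le_sup hy) hr)
  · rw [smul_add]; exact add_mem hy hz
  · rw [smul_comm]; exact Submodule.smul_mem _ _ hy

/-- The inclusion of a submodule, as a morphism in `ModuleCat A`. -/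
noncomputable abbrev submoduleHom {L : Type u} [AddCommGroup L] [Module A L] (N : Submodule A L) :
    ModuleCat.of A N ⟶ ModuleCat.of A L := ModuleCat.ofHom N.subtype

variable [IsNoetherianRing A]

/-- A class in `Ext^p(L, N)`, with `L` finitely generated and `N` an `I`-power torsion module,
vanishes on some `I ^ s L`. The induction on `p` goes through a presentation `0 → K → A^n → L → 0`,
and the Artin–Rees lemma relates `I ^ s A^n ∩ K` with the powers of `I` on `K`. -/
lemma IsPowTorsion.exists_restrict_eq_zero {N : ModuleCat.{u} A} (hN : IsPowTorsion I N) (p : ℕ) :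
    ∀ (L : Type u) [AddCommGroup L] [Module A L] [Module.Finite A L]
      (ξ : Ext (ModuleCat.of A L) N p), ∃ s : ℕ,
        (Ext.mk₀ (submoduleHom (I ^ s • (⊤ : Submodule A L)))).comp ξ (zero_add p) = 0 := by
  induction p with
  | zero =>
    intro L _ _ _ ξ
    obtain ⟨φ, rfl⟩ := (Ext.mk₀_bijective _ _).2 ξ
    obtain ⟨s, hs⟩ := hN.exists_pow_smul_le_ker φ.hom
    refine ⟨s, ?_⟩
    rw [Ext.mk₀_comp_mk₀, Ext.mk₀_eq_zero_iff]
    ext x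
    exact hs x.2
  | succ p ih =>
    intro L _ _ _ ξ
    obtain ⟨n, π, hπ⟩ := Module.Finite.exists_fin' A L
    have hS := LinearMap.shortExact_shortComplexKer hπ
    obtain ⟨η, rfl⟩ := Ext.contravariant_sequence_exact₃ hS N ξ (by
      have : Projective (ModuleCat.of A (Fin n → A)) :=
        (IsProjective.iff_projective _).mp inferInstance
      exact Ext.eq_zero_of_projective _) (add_comm 1 p)
    obtain ⟨s, hs⟩ := ih (LinearMap.ker π) η
    obtain ⟨k, hk⟩ := Ideal.exists_pow_inf_eq_pow_smul I (LinearMap.ker π)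
    refine ⟨k + s, ?_⟩
    set U : Submodule A (Fin n → A) := I ^ (k + s) • ⊤ with hU
    have hmap : U.map π = I ^ (k + s) • (⊤ : Submodule A L) := by
      rw [hU, Submodule.map_smul'', Submodule.map_top, LinearMap.range_eq_top.mpr hπ]
    let π' : U →ₗ[A] (I ^ (k + s) • (⊤ : Submodule A L) : Submodule A L) :=
      π.restrict (fun x hx => hmap ▸ Submodule.mem_map_of_mem hx)
    have hπ' : Function.Surjective π' := by
      rintro ⟨y, hy⟩
      rw [← hmap] at hy
      obtain ⟨x, hx, rfl⟩ := hy
      exact ⟨⟨x, hx⟩, rfl⟩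
    have hS' := LinearMap.shortExact_shortComplexKer hπ'
    let κ : LinearMap.ker π' →ₗ[A] (I ^ s • (⊤ : Submodule A (LinearMap.ker π)) :
        Submodule A (LinearMap.ker π)) :=
      LinearMap.codRestrict _
        (LinearMap.codRestrict _ (U.subtype ∘ₗ (LinearMap.ker π').subtype)
          (fun x => congrArg Subtype.val x.2)) (by
        intro x
        have h1 : (x : Fin n → A) ∈ I ^ (k + s) • ⊤ ⊓ LinearMap.ker π :=
          ⟨x.1.2, congrArg Subtype.val x.2⟩
        rw [hk _ (Nat.le_add_right k s), Nat.add_sub_cancel_left] at h1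
        have h2 := Submodule.smul_mono le_rfl inf_le_right h1
        have h3 : I ^ s • LinearMap.ker π =
            (I ^ s • (⊤ : Submodule A (LinearMap.ker π))).map (LinearMap.ker π).subtype := by
          rw [Submodule.map_smul'', Submodule.map_top, Submodule.range_subtype]
        rw [h3] at h2
        obtain ⟨y, hy, hyx⟩ := h2
        have hy' : y = ⟨x, congrArg Subtype.val x.2⟩ := Subtype.ext hyx
        rw [hy'] at hy
        exact hy)
    let f : π'.shortComplexKer ⟶ π.shortComplexKer :=
      { τ₁ := ModuleCat.ofHom κ ≫ submoduleHom _
        τ₂ := submoduleHom U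
        τ₃ := submoduleHom _
        comm₁₂ := by ext; rfl
        comm₂₃ := by ext; rfl }
    have hf := ShortComplex.ShortExact.extClass_naturality hS' hS f
    have h4 : (Ext.mk₀ f.τ₁).comp η (zero_add p) = 0 := by
      rw [show f.τ₁ = ModuleCat.ofHom κ ≫ submoduleHom _ from rfl, ← Ext.mk₀_comp_mk₀_assoc, hs,
        Ext.comp_zero]
    calc _ = ((Ext.mk₀ f.τ₃).comp hS.extClass (zero_add 1)).comp η (add_comm 1 p) := by
          rw [Ext.comp_assoc _ _ _ _ _ (by lia)]
      _ = _ := by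
          rw [← hf, Ext.comp_assoc _ _ _ _ (zero_add p) (by lia), h4, Ext.comp_zero]

/-- An `I`-power torsion module has no local cohomology in positive degrees. -/
lemma AnnihilatesLocalCohomology.of_isPowTorsion {N : ModuleCat.{u} A} (hN : IsPowTorsion I N)
    (a : A) (p : ℕ) : AnnihilatesLocalCohomology I a N (p + 1) := by
  intro s ξ
  let S (t : ℕ) : ShortComplex (ModuleCat.{u} A) :=
    ShortComplex.mk (ModuleCat.ofHom (I ^ t).subtype) (ModuleCat.ofHom (I ^ t).mkQ)
      (by ext x; exact (Submodule.Quotient.mk_eq_zero _).mpr x.2)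
  have hS (t : ℕ) : (S t).ShortExact :=
    ModuleCat.shortComplex_shortExact _ (LinearMap.exact_subtype_mkQ _)
      (Submodule.subtype_injective _) (Submodule.mkQ_surjective _)
  obtain ⟨η, rfl⟩ := Ext.contravariant_sequence_exact₃ (hS s) N ξ (by
      have : Projective (ModuleCat.of A A) := (IsProjective.iff_projective _).mp inferInstance
      exact Ext.eq_zero_of_projective _) (add_comm 1 p)
  obtain ⟨r, hr⟩ := hN.exists_restrict_eq_zero p ↥(I ^ s) η
  have hle : s ≤ r + s := Nat.le_add_left s r
  let κ : ↥(I ^ (r + s)) →ₗ[A] (I ^ r • (⊤ : Submodule A ↥(I ^ s)) : Submodule A ↥(I ^ s)) :=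
    LinearMap.codRestrict _ (Submodule.inclusion (Ideal.pow_le_pow_right hle)) (by
      intro x
      have h3 : I ^ (r + s) = (I ^ r • (⊤ : Submodule A ↥(I ^ s))).map (I ^ s).subtype := by
        rw [Submodule.map_smul'', Submodule.map_top, Submodule.range_subtype, pow_add]
        rfl
      obtain ⟨y, hy, hyx⟩ := h3.le x.2
      exact (Subtype.ext hyx.symm : Submodule.inclusion _ x = y) ▸ hy)
  let f : S (r + s) ⟶ S s :=
    { τ₁ := ModuleCat.ofHom κ ≫ submoduleHom _
      τ₂ := 𝟙 _
      τ₃ := quotPowMap I hle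
      comm₁₂ := by ext; rfl
      comm₂₃ := by ext; rfl }
  have hf := ShortComplex.ShortExact.extClass_naturality (hS (r + s)) (hS s) f
  have h4 : (Ext.mk₀ f.τ₁).comp η (zero_add p) = 0 := by
    rw [show f.τ₁ = ModuleCat.ofHom κ ≫ submoduleHom _ from rfl, ← Ext.mk₀_comp_mk₀_assoc, hr,
      Ext.comp_zero]
  refine ⟨r + s, hle, ?_⟩
  calc _ = a • ((Ext.mk₀ f.τ₃).comp (hS s).extClass (zero_add 1)).comp η (add_comm 1 p) := by
        rw [Ext.comp_assoc _ _ _ _ _ (by lia)]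
    _ = _ := by
        rw [← hf, Ext.comp_assoc _ _ _ _ (zero_add p) (by lia), h4, Ext.comp_zero, smul_zero]

lemma exists_pow_smul_eq_zero {J : Ideal A} {z : A} (hI : I ≤ (J ⊔ Ideal.span {z}).radical)
    {M : Type*} [AddCommGroup M] [Module A M] {m : M} (hJ : ∀ r ∈ J, r • m = 0)
    {k : ℕ} (hk : z ^ k • m = 0) : ∃ n : ℕ, ∀ r ∈ I ^ n, r • m = 0 := by
  have h1 : I ≤ (J ⊔ Ideal.span {z ^ k}).radical := by
    refine hI.trans ?_
    rw [Ideal.radical_le_radical_iff, sup_le_iff, Ideal.span_singleton_le_iff_mem]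
    exact ⟨le_sup_left.trans Ideal.le_radical,
      k, Ideal.mem_sup_right (Ideal.mem_span_singleton_self _)⟩
  obtain ⟨n, hn⟩ := Ideal.exists_pow_le_of_le_radical_of_fg h1 (IsNoetherian.noetherian I)
  refine ⟨n, fun r hr => ?_⟩
  obtain ⟨u, hu, v, hv, rfl⟩ := Submodule.mem_sup.mp (hn hr)
  obtain ⟨w, rfl⟩ := Ideal.mem_span_singleton'.mp hv
  rw [add_smul, hJ u hu, mul_smul, hk, smul_zero, add_zero]

lemma isPowTorsion_of_smul_eq_zero {J : Ideal A} {z : A} (hI : I ≤ (J ⊔ Ideal.span {z}).radical)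
    {M : Type*} [AddCommGroup M] [Module A M] (hJ : ∀ r ∈ J, ∀ m : M, r • m = 0)
    (hz : ∀ m : M, ∃ k : ℕ, z ^ k • m = 0) : IsPowTorsion I M := fun m =>
  have ⟨_, hk⟩ := hz m
  exists_pow_smul_eq_zero hI (fun r hr => hJ r hr m) hk

/-- A module supported in a closed set on which `I` is, up to radical, generated by one element
`z` has no local cohomology in degrees `≥ 2`: the kernel and the cokernel of `M → M_z` are
`I`-power torsion, and `M_z` has no local cohomology at all. -/
lemma AnnihilatesLocalCohomology.of_smul_eq_zero {J : Ideal A} {z : A} (hzI : z ∈ I)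
    (hI : I ≤ (J ⊔ Ideal.span {z}).radical) {M : ModuleCat.{u} A}
    (hJ : ∀ r ∈ J, ∀ m : M, r • m = 0) (p : ℕ) : AnnihilatesLocalCohomology I 1 M (p + 2) := by
  let W := LocalizedModule (Submonoid.powers z) M
  let f : M →ₗ[A] W := LocalizedModule.mkLinearMap (Submonoid.powers z) M
  have hzW : IsUnit (algebraMap A (Module.End A W) z) :=
    IsLocalizedModule.map_units f ⟨z, Submonoid.mem_powers z⟩
  have hker : IsPowTorsion I (LinearMap.ker f.rangeRestrict) := by
    refine isPowTorsion_of_smul_eq_zero hI (fun r hr m => Subtype.ext (hJ r hr m)) fun m => ?_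
    have h0 : f m = f 0 := by
      rw [map_zero]
      exact congrArg Subtype.val m.2
    obtain ⟨⟨_, k, rfl⟩, hc⟩ := IsLocalizedModule.exists_of_eq (S := Submonoid.powers z) h0
    exact ⟨k, Subtype.ext (Eq.trans hc (smul_zero _))⟩
  have hcoker : IsPowTorsion I (W ⧸ LinearMap.range f) := by
    refine isPowTorsion_of_smul_eq_zero hI (fun r hr m => ?_) fun m => ?_
    all_goals
      obtain ⟨m, rfl⟩ := Submodule.Quotient.mk_surjective _ m
      obtain ⟨⟨x, ⟨_, k, rfl⟩⟩, hx⟩ := IsLocalizedModule.surj (Submonoid.powers z) f m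
    · have : r • m = 0 := by
        have h1 : z ^ k • r • m = 0 := by
          rw [smul_comm]
          refine (congrArg (r • ·) hx).trans ?_
          change r • f x = 0
          rw [← map_smul, hJ r hr, map_zero]
        have h2 := (Module.End.isUnit_iff _).mp (hzW.pow k)
        rw [← map_pow] at h2
        exact h2.1 (h1.trans (map_zero _).symm)
      rw [← Submodule.Quotient.mk_smul, this, Submodule.Quotient.mk_zero]
    · refine ⟨k, ?_⟩
      rw [← Submodule.Quotient.mk_smul, Submodule.Quotient.mk_eq_zero]
      exact ⟨x, hx.symm⟩
  have h1 : AnnihilatesLocalCohomology I 1 (ModuleCat.of A (LinearMap.range f)) (p + 2) := by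
    have := first (I := I) (a := 1) (b := 1) (p := p + 1)
      (S := ShortComplex.mk (ModuleCat.ofHom (LinearMap.range f).subtype)
        (ModuleCat.ofHom (LinearMap.range f).mkQ) (by ext; simp))
      (ModuleCat.shortComplex_shortExact _ (LinearMap.exact_subtype_mkQ _)
      (Submodule.subtype_injective _) (Submodule.mkQ_surjective _))
      (of_isPowTorsion hcoker 1 p) (of_bijective_smul hzI hzW)
    simpa using this
  simpa using second (LinearMap.shortExact_shortComplexKer f.surjective_rangeRestrict)
    (of_isPowTorsion hker 1 (p + 1)) h1

end Macaulayfication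

end

/-! ### Koszul complexes -/

section

open CategoryTheory Limits Opposite Abelian

namespace Macaulayfication

variable {A : Type u} [CommRing A]

/-- The terms of the Koszul complex of a list of elements with coefficients in `M`, as iterated
mapping cones: `K_{p+1}(y :: l) = K_{p+1}(l) × K_p(l)`. -/
noncomputable def koszulX (M : ModuleCat.{u} A) : List A → ℕ → ModuleCat.{u} A
  | [], 0 => M
  | [], _ + 1 => ModuleCat.of A PUnit
  | _ :: l, 0 => koszulX M l 0
  | _ :: l, p + 1 => ModuleCat.of A (koszulX M l (p + 1) × koszulX M l p)

/-- The differential of the Koszul complex: `(a, b) ↦ (d a + y b, -d b)` on the cone of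
multiplication by `y`. -/
noncomputable def koszulD (M : ModuleCat.{u} A) :
    ∀ (l : List A) (p : ℕ), koszulX M l (p + 1) →ₗ[A] koszulX M l p
  | [], _ => 0
  | y :: l, 0 => LinearMap.coprod (koszulD M l 0) (y • LinearMap.id)
  | y :: l, p + 1 =>
    LinearMap.prod (LinearMap.coprod (koszulD M l (p + 1)) (y • LinearMap.id))
      (-(koszulD M l p) ∘ₗ LinearMap.snd A _ _)

variable {M : ModuleCat.{u} A}

lemma koszulD_comp (l : List A) (p : ℕ) (c : koszulX M l (p + 2)) :
    koszulD M l p (koszulD M l (p + 1) c) = 0 := by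
  induction l generalizing p with
  | nil => rfl
  | cons y l ih =>
    obtain ⟨a, b⟩ := c
    cases p with
    | zero =>
      change koszulD M l 0 (koszulD M l 1 a + y • b) + y • (-(koszulD M l 0 b)) = 0
      rw [map_add, ih, map_smul]
      simp
    | succ p =>
      refine Prod.ext ?_ ?_
      · change koszulD M l (p + 1) (koszulD M l (p + 2) a + y • b) +
          y • (-(koszulD M l (p + 1) b)) = 0
        rw [map_add, ih, map_smul]
        simp
      · change -(koszulD M l p (-(koszulD M l (p + 1) b))) = 0
        rw [map_neg, ih, neg_zero, neg_zero]

/-- Multiplication by a member `y` of the list is null-homotopic on the Koszul complex. This is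
stated for terms of degree `0` and `p + 1` separately. -/
lemma exists_koszul_homotopy (l : List A) {y : A} (hy : y ∈ l) :
    ∃ s : ∀ p, koszulX M l p →ₗ[A] koszulX M l (p + 1),
      (∀ c, koszulD M l 0 (s 0 c) = y • c) ∧
      ∀ p c, koszulD M l (p + 1) (s (p + 1) c) + s p (koszulD M l p c) = y • c := by
  induction l with
  | nil => simp at hy
  | cons z l ih =>
    rcases List.mem_cons.mp hy with rfl | hy
    · refine ⟨fun p => match p with
        | 0 => LinearMap.inr A _ _
        | p + 1 => LinearMap.inr A _ _ ∘ₗ LinearMap.fst A _ _, fun c => ?_, fun p c => ?_⟩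
      · change koszulX M l 0 at c
        change koszulD M l 0 0 + y • c = y • c
        rw [map_zero, zero_add]
      · obtain ⟨a, b⟩ := c
        cases p with
        | zero =>
          refine Prod.ext ?_ ?_
          · change koszulD M l 1 0 + y • a + 0 = y • a
            rw [map_zero, zero_add, add_zero]
          · change -(koszulD M l 0 a) + (koszulD M l 0 a + y • b) = y • b
            rw [neg_add_cancel_left]
        | succ p =>
          refine Prod.ext ?_ ?_
          · change koszulD M l (p + 2) 0 + y • a + 0 = y • a
            rw [map_zero, zero_add, add_zero]
          · change -(koszulD M l (p + 1) a) + (koszulD M l (p + 1) a + y • b) = y • b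
            rw [neg_add_cancel_left]
    · obtain ⟨s, h0, hs⟩ := ih hy
      refine ⟨fun p => match p with
        | 0 => LinearMap.inl A _ _ ∘ₗ s 0
        | p + 1 => LinearMap.prodMap (s (p + 1)) (-(s p)), fun c => ?_, fun p c => ?_⟩
      · change koszulX M l 0 at c
        change koszulD M l 0 (s 0 c) + z • 0 = y • c
        rw [h0, smul_zero, add_zero]
      · obtain ⟨a, b⟩ := c
        cases p with
        | zero =>
          refine Prod.ext ?_ ?_
          · change koszulD M l 1 (s 1 a) + z • (-(s 0 b)) + s 0 (koszulD M l 0 a + z • b) = y • a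
            rw [← hs, map_add, map_smul]
            module
          · change -(koszulD M l 0 (-(s 0 b))) + 0 = y • b
            rw [map_neg, h0, neg_neg, add_zero]
        | succ p =>
          refine Prod.ext ?_ ?_
          · change koszulD M l (p + 2) (s (p + 2) a) + z • (-(s (p + 1) b)) +
              s (p + 1) (koszulD M l (p + 1) a + z • b) = y • a
            rw [← hs, map_add, map_smul]
            module
          · change -(koszulD M l (p + 1) (-(s (p + 1) b))) + -(s p (-(koszulD M l p b))) = y • b
            rw [← hs, map_neg, map_neg, neg_neg, neg_neg]

lemma subsingleton_koszulX (l : List A) {p : ℕ} (hp : l.length < p) :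
    Subsingleton (koszulX M l p) := by
  induction l generalizing p with
  | nil =>
    cases p with
    | zero => simp at hp
    | succ p => exact inferInstanceAs (Subsingleton PUnit)
  | cons y l ih =>
    cases p with
    | zero => simp at hp
    | succ p =>
      have h1 := ih (p := p + 1) (by simp at hp; omega)
      have h2 := ih (p := p) (by simp at hp; omega)
      exact inferInstanceAs (Subsingleton (_ × _))

lemma smul_koszulX_eq_zero {r : A} (hr : ∀ m : M, r • m = 0) (l : List A) (p : ℕ)
    (c : koszulX M l p) : r • c = 0 := by
  induction l generalizing p with
  | nil =>
    cases p with
    | zero => exact hr c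
    | succ p => rfl
  | cons y l ih =>
    cases p with
    | zero => exact ih 0 c
    | succ p => exact Prod.ext (ih _ _) (ih _ _)

lemma AnnihilatesLocalCohomology.koszulX {I : Ideal A} {a : A} {q : ℕ}
    (h : AnnihilatesLocalCohomology I a M q) (l : List A) (p : ℕ) :
    AnnihilatesLocalCohomology I a (koszulX M l p) q := by
  induction l generalizing p with
  | nil =>
    cases p with
    | zero => exact h
    | succ p => exact of_subsingleton (M := ModuleCat.of A PUnit)
  | cons y l ih =>
    cases p with
    | zero => exact ih 0
    | succ p => exact prod (ih _) (ih _)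

/-- The Koszul homology in degree `0` is `M ⧸ (l)M`. -/
lemma exists_koszulX_zero_equiv (l : List A) : ∃ e : koszulX M l 0 ≃ₗ[A] M,
    (LinearMap.range (koszulD M l 0)).map e.toLinearMap = Ideal.span {y | y ∈ l} • ⊤ := by
  induction l with
  | nil =>
    refine ⟨LinearEquiv.refl A M, ?_⟩
    change (LinearMap.range (0 : _ →ₗ[A] _)).map _ = _
    rw [LinearMap.range_zero, Submodule.map_bot]
    simp
  | cons y l ih =>
    obtain ⟨e, he⟩ := ih
    refine ⟨e, ?_⟩
    change (LinearMap.range (LinearMap.coprod (koszulD M l 0) (y • LinearMap.id))).map _ = _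
    have : {x | x ∈ y :: l} = insert y {x | x ∈ l} := by ext; simp
    rw [LinearMap.range_coprod, Submodule.map_sup, he, this, Ideal.span_insert, Submodule.sup_smul,
      sup_comm, Submodule.ideal_span_singleton_smul]
    congr 1
    ext m
    simp only [Submodule.mem_map, LinearMap.mem_range, LinearMap.smul_apply, LinearMap.id_apply,
      Submodule.mem_smul_pointwise_iff_exists, Submodule.mem_top, true_and]
    constructor
    · rintro ⟨_, ⟨c, rfl⟩, rfl⟩
      exact ⟨e c, by simp⟩
    · rintro ⟨c, rfl⟩
      exact ⟨_, ⟨e.symm c, rfl⟩, by simp⟩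

end Macaulayfication

end

/-! ### Colon ideals and Koszul boundaries -/

section

open CategoryTheory Limits Opposite Abelian

namespace Macaulayfication

variable {A : Type u} [CommRing A] {I : Ideal A} {M : ModuleCat.{u} A}

lemma AnnihilatesLocalCohomology.smul_eq_zero {a : A} (h : AnnihilatesLocalCohomology I a M 0)
    {m : M} {s : ℕ} (hm : ∀ r ∈ I ^ s, r • m = 0) : a • m = 0 := by
  let φ : (A ⧸ I ^ s) →ₗ[A] M :=
    Submodule.liftQ _ (LinearMap.toSpanSingleton A M m) fun r hr => hm r hr
  obtain ⟨t, hst, h0⟩ := h s (Ext.mk₀ (ModuleCat.ofHom φ))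
  rw [Ext.mk₀_comp_mk₀, ← Ext.mk₀_smul, Ext.mk₀_eq_zero_iff] at h0
  have := congr(($h0).hom (Submodule.Quotient.mk 1))
  have h1 : φ (Submodule.Quotient.mk 1) = m := one_smul A m
  rw [← h1]
  exact this

lemma koszul_homology_smul (l : List A) {r : A} (hr : r ∈ Ideal.span {y | y ∈ l}) {p : ℕ}
    {c : koszulX M l (p + 1)} (hc : koszulD M l p c = 0) :
    r • c ∈ LinearMap.range (koszulD M l (p + 1)) := by
  induction hr using Submodule.span_induction with
  | mem y hy =>
    obtain ⟨s, -, hs⟩ := exists_koszul_homotopy (M := M) l hy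
    refine ⟨s (p + 1) c, ?_⟩
    rw [← hs, hc, map_zero, add_zero]
  | zero => simp
  | add x y _ _ hx hy => rw [add_smul]; exact add_mem hx hy
  | smul a x _ hx => rw [smul_assoc]; exact Submodule.smul_mem _ _ hx

variable [IsNoetherianRing A]

/-- Let `k` be the length of `l`, and let `a p` annihilate `H_I^p(M)`. The product of the `a p` with
`j < p ≤ k` annihilates `H_I^{j+1}` of the module of boundaries in degree `j` of the Koszul
complex. Descending induction on `j` along `0 → Z_{j+1} → K_{j+1} → B_j → 0` and
`0 → B_{j+1} → Z_{j+1} → H_{j+1} → 0`; the Koszul homology is killed by `(l) + J`, so it has no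
local cohomology in degrees `≥ 2`. -/
lemma AnnihilatesLocalCohomology.range_koszulD (l : List A) {J : Ideal A} {z : A} (hzI : z ∈ I)
    (hI : I ≤ (Ideal.span {y | y ∈ l} ⊔ J ⊔ Ideal.span {z}).radical)
    (hJ : ∀ r ∈ J, ∀ m : M, r • m = 0) (a : ℕ → A)
    (ha : ∀ p ≤ l.length, AnnihilatesLocalCohomology I (a p) M p) (n j : ℕ)
    (hnj : n + j = l.length) :
    AnnihilatesLocalCohomology I (∏ p ∈ Finset.range n, a (j + 1 + p))
      (ModuleCat.of A (LinearMap.range (koszulD M l j))) (j + 1) := by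
  induction n generalizing j with
  | zero =>
    have := subsingleton_koszulX (M := M) l (p := j + 1) (by omega)
    have : Subsingleton (LinearMap.range (koszulD M l j)) :=
      (koszulD M l j).surjective_rangeRestrict.subsingleton
    exact of_subsingleton
  | succ n ih =>
    let B := (LinearMap.range (koszulD M l (j + 1))).submoduleOf (LinearMap.ker (koszulD M l j))
    have hBle : LinearMap.range (koszulD M l (j + 1)) ≤ LinearMap.ker (koszulD M l j) := by
      rintro _ ⟨c, rfl⟩
      exact koszulD_comp l j c
    let e := Submodule.submoduleOfEquivOfLe hBle
    have hB : AnnihilatesLocalCohomology I (∏ p ∈ Finset.range n, a (j + 1 + 1 + p))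
        (ModuleCat.of A B) (j + 2) :=
      (ih (j + 1) (by omega)).of_retract (ModuleCat.ofHom e.toLinearMap)
        (ModuleCat.ofHom e.symm.toLinearMap) (by ext x; simp)
    have hH : AnnihilatesLocalCohomology I 1
        (ModuleCat.of A (LinearMap.ker (koszulD M l j) ⧸ B)) (j + 2) := by
      refine of_smul_eq_zero hzI hI (fun r hr c => ?_) j
      obtain ⟨c, rfl⟩ := Submodule.Quotient.mk_surjective _ c
      rw [← Submodule.Quotient.mk_smul, Submodule.Quotient.mk_eq_zero]
      obtain ⟨u, hu, v, hv, rfl⟩ := Submodule.mem_sup.mp hr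
      have h1 : v • c = 0 := Subtype.ext (smul_koszulX_eq_zero (hJ v hv) l _ _)
      rw [add_smul, h1, add_zero]
      exact koszul_homology_smul l hu c.2
    have hZ := second (I := I)
      (S := ShortComplex.mk (ModuleCat.ofHom B.subtype) (ModuleCat.ofHom B.mkQ)
        (by ext x; exact (Submodule.Quotient.mk_eq_zero _).mpr x.2))
      (ModuleCat.shortComplex_shortExact _ (LinearMap.exact_subtype_mkQ _)
        (Submodule.subtype_injective _) (Submodule.mkQ_surjective _)) hB hH
    have := third (I := I)
      (LinearMap.shortExact_shortComplexKer (koszulD M l j).surjective_rangeRestrict)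
      ((ha (j + 1) (by omega)).koszulX l (j + 1)) (b := (∏ p ∈ Finset.range n, a (j + 1 + 1 + p)))
      (p := j + 1) (by
        rw [mul_one] at hZ
        change AnnihilatesLocalCohomology I _
          (ModuleCat.of A (LinearMap.ker (koszulD M l j).rangeRestrict)) _
        rw [LinearMap.ker_rangeRestrict]
        exact hZ)
    rw [Finset.prod_range_succ', mul_comm]
    convert this using 3 with p
    ring_nf

/-- Let `k` be the length of `l`. If `(l) + J + (z)` contains `I` up to radical, where `z ∈ I` and
`J M = 0`, then the product of annihilators of `H_I^p(M)` over `0 ≤ p ≤ k` maps `(l)M : z` into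
`(l)M`. -/
theorem prod_smul_mem_of_smul_mem (l : List A) {J : Ideal A} {z : A} (hzI : z ∈ I)
    (hI : I ≤ (Ideal.span {y | y ∈ l} ⊔ J ⊔ Ideal.span {z}).radical)
    (hJ : ∀ r ∈ J, ∀ m : M, r • m = 0) (a : ℕ → A)
    (ha : ∀ p ≤ l.length, AnnihilatesLocalCohomology I (a p) M p) {m : M}
    (hm : z • m ∈ Ideal.span {y | y ∈ l} • (⊤ : Submodule A M)) :
    (∏ p ∈ Finset.range (l.length + 1), a p) • m ∈
      Ideal.span {y | y ∈ l} • (⊤ : Submodule A M) := by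
  obtain ⟨e, he⟩ := exists_koszulX_zero_equiv (M := M) l
  have key (c : koszulX M l 0) : e c ∈ Ideal.span {y | y ∈ l} • (⊤ : Submodule A M) ↔
      c ∈ LinearMap.range (koszulD M l 0) := by
    rw [← he, Submodule.mem_map_equiv]
    simp
  obtain ⟨c, rfl⟩ := e.surjective m
  rw [← map_smul, key] at hm ⊢
  have h1 := AnnihilatesLocalCohomology.range_koszulD l hzI hI hJ a ha l.length 0 (by omega)
  have h2 := AnnihilatesLocalCohomology.third (I := I)
      (S := ShortComplex.mk (ModuleCat.ofHom (LinearMap.range (koszulD M l 0)).subtype)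
        (ModuleCat.ofHom (LinearMap.range (koszulD M l 0)).mkQ)
        (by ext x; exact (Submodule.Quotient.mk_eq_zero _).mpr x.2))
      (ModuleCat.shortComplex_shortExact _ (LinearMap.exact_subtype_mkQ _)
        (Submodule.subtype_injective _) (Submodule.mkQ_surjective _))
      ((ha 0 (by omega)).koszulX l 0) h1
  -- The class of `c` in `M ⧸ (l)M` is killed by a power of `I`.
  obtain ⟨s, hs⟩ := exists_pow_smul_eq_zero (k := 1) hI
    (m := (Submodule.Quotient.mk c : koszulX M l 0 ⧸ LinearMap.range (koszulD M l 0)))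
    (fun r hr => by
      rw [← Submodule.Quotient.mk_smul, Submodule.Quotient.mk_eq_zero]
      obtain ⟨u, hu, v, hv, rfl⟩ := Submodule.mem_sup.mp hr
      rw [add_smul, smul_koszulX_eq_zero (hJ v hv), add_zero, ← key, map_smul]
      exact Submodule.smul_mem_smul hu trivial)
    (by rwa [pow_one, ← Submodule.Quotient.mk_smul, Submodule.Quotient.mk_eq_zero])
  have h3 := h2.smul_eq_zero (m := Submodule.Quotient.mk c) hs
  rw [← Submodule.Quotient.mk_smul, Submodule.Quotient.mk_eq_zero] at h3
  rw [Finset.prod_range_succ', mul_comm]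
  simpa [add_comm] using h3

end Macaulayfication

end

/-! ### The cohomology annihilator of a module over a local ring -/

section

open IsLocalRing

namespace Macaulayfication

section Quot
variable {A : Type*} [CommRing A]

lemma mk_mem_smul_top_iff {𝔟 K : Ideal A} {c : A} :
    (Submodule.Quotient.mk c : A ⧸ 𝔟) ∈ K • (⊤ : Submodule A (A ⧸ 𝔟)) ↔ c ∈ 𝔟 ⊔ K := by
  rw [← Submodule.mkQ_apply, ← Submodule.mem_comap]
  have : K • (⊤ : Submodule A (A ⧸ 𝔟)) = Submodule.map (Submodule.mkQ 𝔟) K := by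
    rw [← Submodule.range_mkQ 𝔟, ← Submodule.map_top, ← Submodule.map_smul'', Ideal.smul_top_eq_map]
    simp
  rw [this, Submodule.comap_map_mkQ]

end Quot

variable {A : Type u} [CommRing A] [IsLocalRing A]

/-- A criterion for `cohomologyAnnihilator A M ≤ K` on generators, where the product may be cut off
at any `r ≤ dim M`. -/
lemma cohomologyAnnihilator_le {M : Type u} [AddCommGroup M] [Module A M] {r : ℕ}
    (hr : r ≤ moduleDim A M) {K : Ideal A}
    (hK : ∀ a : ℕ → A, (∀ p < r, a p ∈ Module.annihilator A
      ((localCohomology (maximalIdeal A) p).obj (ModuleCat.of A M))) →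
        ∏ p ∈ Finset.range r, a p ∈ K) :
    cohomologyAnnihilator A M ≤ K := by
  refine (Ideal.le_of_dvd (Finset.prod_dvd_prod_of_subset _ _ _
    (Finset.range_subset_range.mpr hr))).trans ?_
  rw [Finset.prod_congr rfl fun p _ => (Ideal.span_eq (Module.annihilator A
    ((localCohomology (maximalIdeal A) p).obj (ModuleCat.of A M)))).symm, Ideal.prod_span,
    Ideal.span_le]
  intro b hb
  obtain ⟨a, ha, rfl⟩ := (Set.mem_finsetProd _ _ _).mp hb
  exact hK a fun p hp => ha (Finset.mem_range.mpr hp)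

variable [IsNoetherianRing A]

/-- Krull's intersection theorem for `M ⧸ N`. -/
lemma mem_of_forall_mem_sup_pow {M : Type*} [AddCommGroup M] [Module A M] [Module.Finite A M]
    {N : Submodule A M} {m : M}
    (h : ∀ n : ℕ, m ∈ N ⊔ maximalIdeal A ^ n • (⊤ : Submodule A M)) : m ∈ N := by
  have h1 : (Submodule.Quotient.mk m : M ⧸ N) ∈
      (⨅ n : ℕ, maximalIdeal A ^ n • ⊤ : Submodule A (M ⧸ N)) := by
    rw [Submodule.mem_iInf]
    intro n
    have h2 : maximalIdeal A ^ n • (⊤ : Submodule A (M ⧸ N)) =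
        (maximalIdeal A ^ n • (⊤ : Submodule A M)).map N.mkQ := by
      rw [Submodule.map_smul'', Submodule.map_top, Submodule.range_mkQ]
    rw [h2, ← Submodule.mkQ_apply, ← Submodule.mem_comap, Submodule.comap_map_mkQ]
    exact h n
  rw [Ideal.iInf_pow_smul_eq_bot_of_isLocalRing _ (maximalIdeal.isMaximal A).ne_top] at h1
  exact (Submodule.Quotient.mk_eq_zero N).mp h1

/-- Let `y i`, `i ∈ U`, be elements of the maximal ideal that generate an ideal primary to it modulo
an ideal `𝔟` which kills `M`, and suppose that there are at most `dim M` of them. Then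
`cohomologyAnnihilator A M` maps `QM : y u` into `QM`, where `Q` is generated by some of the `y i`
with `i ≠ u`. -/
theorem smul_mem_of_mem_cohomologyAnnihilator {M : Type u} [AddCommGroup M] [Module A M]
    [Module.Finite A M] {a : A} (ha : a ∈ cohomologyAnnihilator A M) {𝔟 : Ideal A}
    (h𝔟 : ∀ r ∈ 𝔟, ∀ m : M, r • m = 0) {ι : Type*} (y : ι → A) (U : Finset ι)
    (hU : U.card ≤ moduleDim A M) (hyU : ∀ i ∈ U, y i ∈ maximalIdeal A)
    (hrad : maximalIdeal A ≤ (𝔟 ⊔ Ideal.span (y '' U)).radical) {Λ : Finset ι} (hΛ : Λ ⊆ U)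
    {u : ι} (hu : u ∈ U) (huΛ : u ∉ Λ) {m : M}
    (hm : y u • m ∈ Ideal.span (y '' Λ) • (⊤ : Submodule A M)) :
    a • m ∈ Ideal.span (y '' Λ) • (⊤ : Submodule A M) := by
  classical
  refine mem_of_forall_mem_sup_pow fun n => ?_
  -- It suffices to work modulo high powers of the elements outside of `Λ` and `u`, which gives a
  -- list of length `U.card - 1`.
  let w : ι → A := fun i => if i ∈ Λ then y i else y i ^ (n + 1)
  let l : List A := (U.erase u).toList.map w
  have hl : l.length + 1 = U.card := by
    simp only [l, List.length_map, Finset.length_toList]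
    exact Finset.card_erase_add_one hu
  have hlset : {z | z ∈ l} = w '' (U.erase u) := by
    ext z
    simp [l, and_comm]
  have hΛw : y '' Λ ⊆ w '' (U.erase u) := by
    rintro _ ⟨i, hi, rfl⟩
    exact ⟨i, Finset.mem_erase.mpr ⟨fun h => huΛ (h ▸ hi), hΛ hi⟩, if_pos hi⟩
  have hle : Ideal.span {z | z ∈ l} ≤ Ideal.span (y '' Λ) ⊔ maximalIdeal A ^ n := by
    rw [hlset, Ideal.span_le]
    rintro _ ⟨i, hi, rfl⟩
    by_cases h : i ∈ Λ
    · exact Ideal.mem_sup_left (Ideal.subset_span ⟨i, h, (if_pos h).symm⟩)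
    · simp only [w, if_neg h]
      exact Ideal.mem_sup_right (Ideal.pow_le_pow_right n.le_succ
        (Ideal.pow_mem_pow (hyU i (Finset.mem_of_mem_erase hi)) _))
  suffices h : a • m ∈ Ideal.span {z | z ∈ l} • (⊤ : Submodule A M) by
    rw [← Submodule.sup_smul]
    exact Submodule.smul_mono_left hle h
  suffices h : cohomologyAnnihilator A M ≤
      (Ideal.span {z | z ∈ l} • (⊤ : Submodule A M)).colon {m} from
    Submodule.mem_colon_singleton.mp (h ha)
  refine cohomologyAnnihilator_le (r := l.length + 1) (by omega) fun b hb => ?_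
  rw [Submodule.mem_colon_singleton]
  refine prod_smul_mem_of_smul_mem (M := ModuleCat.of A M) (I := maximalIdeal A) l (J := 𝔟)
    (hyU u hu) ?_ h𝔟 b (fun p hp => .of_mem_annihilator (hb p (by omega))) ?_
  · refine hrad.trans ?_
    rw [Ideal.radical_le_radical_iff, sup_le_iff, Ideal.span_le]
    refine ⟨le_trans (le_sup_right.trans le_sup_left) Ideal.le_radical, ?_⟩
    rintro _ ⟨i, hi, rfl⟩
    by_cases hiu : i = u
    · exact Ideal.le_radical (Ideal.mem_sup_right (hiu ▸ Ideal.mem_span_singleton_self _))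
    · have hw : w i ∈ Ideal.span {z | z ∈ l} ⊔ 𝔟 ⊔ Ideal.span {y u} := by
        refine Ideal.mem_sup_left (Ideal.mem_sup_left (Ideal.subset_span ?_))
        rw [hlset]
        exact ⟨i, Finset.mem_erase.mpr ⟨hiu, hi⟩, rfl⟩
      by_cases h : i ∈ Λ
      · simp only [w, if_pos h] at hw
        exact Ideal.le_radical hw
      · simp only [w, if_neg h] at hw
        exact ⟨n + 1, hw⟩
  · refine Submodule.smul_mono_left (Ideal.span_mono ?_) hm
    rw [hlset]
    exact hΛw

lemma le_moduleDim_quotient_span {d : ℕ} (hd : ringKrullDim A = d) {ι : Type*} (x : ι → A)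
    (hx : ∀ i, x i ∈ maximalIdeal A) (T : Finset ι) {r : ℕ} (hr : r + T.card ≤ d) :
    r ≤ moduleDim A (A ⧸ Ideal.span (x '' T)) := by
  have h1 := ringKrullDim_le_ringKrullDim_quotient_add_encard (x '' T) (by
    rintro _ ⟨i, -, rfl⟩
    rw [SetLike.mem_coe, IsLocalRing.ringJacobson_eq_maximalIdeal]
    exact hx i)
  have h2 : ringKrullDim (A ⧸ Ideal.span (x '' T)) ≤ ringKrullDim A :=
    ringKrullDim_quotient_le _
  have h3 : (x '' T).encard ≤ T.card := by
    refine (Set.encard_image_le _ _).trans ?_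
    simp
  rw [moduleDim, Module.supportDim_quotient_eq_ringKrullDim]
  rw [hd] at h1 h2
  generalize ringKrullDim (A ⧸ Ideal.span (x '' T)) = e at h1 h2
  generalize (x '' (T : Set ι)).encard = c at h1 h3
  induction e with
  | bot => simp at h1
  | coe e =>
    have h4 : e ≤ (d : ℕ∞) := by exact_mod_cast h2
    lift e to ℕ using ne_top_of_le_ne_top (ENat.natCast_ne_top d) h4
    lift c to ℕ using ne_top_of_le_ne_top (ENat.natCast_ne_top _) h3
    have h5 : d ≤ e + c := by exact_mod_cast h1
    have h6 : c ≤ T.card := by exact_mod_cast h3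
    change r ≤ e
    omega

end Macaulayfication

end

/-! ### Powers of ideals generated by d-sequences -/

section

namespace Macaulayfication

variable {A : Type u} [CommRing A]

lemma span_image_Iio_succ (y : ℕ → A) (l : ℕ) :
    Ideal.span (y '' Set.Iio (l + 1)) = Ideal.span (y '' Set.Iio l) ⊔ Ideal.span {y l} := by
  rw [← Order.succ_eq_add_one, Order.Iio_succ_eq_insert, Set.image_insert_eq, Ideal.span_insert,
    sup_comm]

section Colon

variable {N : Ideal A} {y : ℕ → A} {h : ℕ}

/-- For a d-sequence `y` modulo `N`:
`((N, y 0, …, y (l-1)) : y l) ∩ (N, y) = (N, y 0, …, y (l-1))`. -/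
lemma mem_sup_of_mul_mem_sup
    (hy : ∀ l k, l ≤ k → k < h → ∀ c, y l * (y k * c) ∈ N ⊔ Ideal.span (y '' Set.Iio l) →
      y k * c ∈ N ⊔ Ideal.span (y '' Set.Iio l)) {l : ℕ} (hl : l < h) {b : A}
    (hb : b ∈ N ⊔ Ideal.span (y '' Set.Iio h)) (hlb : y l * b ∈ N ⊔ Ideal.span (y '' Set.Iio l)) :
    b ∈ N ⊔ Ideal.span (y '' Set.Iio l) := by
  induction h, hl using Nat.le_induction with
  | base =>
    rw [span_image_Iio_succ, ← sup_assoc] at hb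
    obtain ⟨a, ha, _, hz, rfl⟩ := Submodule.mem_sup.mp hb
    obtain ⟨z, rfl⟩ := Ideal.mem_span_singleton'.mp hz
    refine add_mem ha ?_
    rw [mul_comm]
    refine hy l l le_rfl (Nat.lt_succ_self l) z ?_
    have := sub_mem hlb (Ideal.mul_mem_left _ (y l) ha)
    convert this using 1
    ring
  | succ k hk ih =>
    have hlk : l ≤ k := Nat.le_of_succ_le hk
    have hle : N ⊔ Ideal.span (y '' Set.Iio l) ≤ N ⊔ Ideal.span (y '' Set.Iio k) :=
      sup_le_sup_left (Ideal.span_mono (Set.image_mono (Set.Iio_subset_Iio hlk))) _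
    refine ih (fun l k' h1 h2 => hy l k' h1 (by omega)) ?_
    rw [span_image_Iio_succ, ← sup_assoc] at hb
    obtain ⟨a, ha, _, hz, hab⟩ := Submodule.mem_sup.mp hb
    obtain ⟨z, rfl⟩ := Ideal.mem_span_singleton'.mp hz
    have h1 : y k * b ∈ N ⊔ Ideal.span (y '' Set.Iio k) := by
      refine hle (hy l k hlk (Nat.lt_succ_self k) b ?_)
      rw [mul_left_comm]
      exact Ideal.mul_mem_left _ _ hlb
    rw [← hab]
    refine add_mem ha ?_
    rw [mul_comm]
    refine hy k k le_rfl (Nat.lt_succ_self k) z ?_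
    have := sub_mem h1 (Ideal.mul_mem_left _ (y k) ha)
    rw [← hab] at this
    convert this using 1
    ring

/-- Huneke's lemma on powers of the ideal `𝔮` generated by a d-sequence modulo `N`:
the intersection of `N + 𝔮 ^ (n+1)` and `N + (y 0, …, y (l-1))` is contained in
`N + (y 0, …, y (l-1)) 𝔮 ^ n`. -/
lemma mem_sup_mul_pow
    (hy : ∀ l k, l ≤ k → k < h → ∀ c, y l * (y k * c) ∈ N ⊔ Ideal.span (y '' Set.Iio l) →
      y k * c ∈ N ⊔ Ideal.span (y '' Set.Iio l)) (n : ℕ) {l : ℕ} (hl : l ≤ h) {b : A}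
    (hb : b ∈ N ⊔ Ideal.span (y '' Set.Iio h) ^ (n + 1))
    (hlb : b ∈ N ⊔ Ideal.span (y '' Set.Iio l)) :
    b ∈ N ⊔ Ideal.span (y '' Set.Iio l) * Ideal.span (y '' Set.Iio h) ^ n := by
  induction n generalizing l b with
  | zero => simpa using hlb
  | succ n ih =>
    set q := Ideal.span (y '' Set.Iio h) with hq
    induction hl using Nat.decreasingInduction generalizing b with
    | self => rwa [← pow_succ']
    | of_succ l hl ihl =>
      have hle : N ⊔ Ideal.span (y '' Set.Iio l) ≤ N ⊔ Ideal.span (y '' Set.Iio (l + 1)) :=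
        sup_le_sup_left (Ideal.span_mono (Set.image_mono (Set.Iio_subset_Iio l.le_succ))) _
      have h1 := ihl (hle hlb) hb
      rw [span_image_Iio_succ, Ideal.sup_mul, ← sup_assoc] at h1
      obtain ⟨a, ha, _, hz, rfl⟩ := Submodule.mem_sup.mp h1
      obtain ⟨g, hg, rfl⟩ := Ideal.mem_span_singleton_mul.mp hz
      refine add_mem ha ?_
      have h2 : y l * g ∈ N ⊔ Ideal.span (y '' Set.Iio l) := by
        have hle' : N ⊔ Ideal.span (y '' Set.Iio l) * q ^ (n + 1) ≤
            N ⊔ Ideal.span (y '' Set.Iio l) := sup_le_sup_left Ideal.mul_le_left N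
        have := sub_mem hlb (hle' ha)
        rwa [add_sub_cancel_left] at this
      have h3 : g ∈ N ⊔ q ^ (n + 1) := Ideal.mem_sup_right hg
      have h4 := ih hl.le h3
        (mem_sup_of_mul_mem_sup hy hl (sup_le_sup_left (Ideal.pow_le_self n.succ_ne_zero) N h3) h2)
      obtain ⟨ν, hν, δ, hδ, rfl⟩ := Submodule.mem_sup.mp h4
      rw [mul_add]
      refine add_mem (Ideal.mem_sup_left (Ideal.mul_mem_left _ _ hν)) (Ideal.mem_sup_right ?_)
      have hyl : y l ∈ q := Ideal.subset_span ⟨l, hl, rfl⟩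
      have := Ideal.mul_mem_mul hδ hyl
      rwa [mul_assoc, ← pow_succ, mul_comm δ] at this

/-- If `y` generates `𝔮` and is a d-sequence modulo `Q + (u)`, then
`(Q + 𝔮 ^ (n+1)) : u ⊆ 𝔮 ^ n ((Q + 𝔮) : u) + (Q : u)`. The proof is by induction on `n`, and for
fixed `n` it peels off the generators of the first factor of `𝔮 ^ (n+2) = 𝔮 𝔮 ^ (n+1)` one at a
time. -/
theorem mem_of_mul_mem_sup_pow {Q : Ideal A} {u : A}
    (hy : ∀ l k, l ≤ k → k < h → ∀ c,
      y l * (y k * c) ∈ (Q ⊔ Ideal.span {u}) ⊔ Ideal.span (y '' Set.Iio l) →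
      y k * c ∈ (Q ⊔ Ideal.span {u}) ⊔ Ideal.span (y '' Set.Iio l)) (n : ℕ) {m : A}
    (hm : u * m ∈ Q ⊔ Ideal.span (y '' Set.Iio h) ^ (n + 1)) :
    m ∈ Ideal.span (y '' Set.Iio h) ^ n *
        (Q ⊔ Ideal.span (y '' Set.Iio h)).colon {u} ⊔ Q.colon {u} := by
  set q := Ideal.span (y '' Set.Iio h) with hq
  induction n generalizing m with
  | zero =>
    rw [pow_zero, one_mul]
    refine Ideal.mem_sup_left (Submodule.mem_colon_singleton.mpr ?_)
    rwa [zero_add, pow_one, mul_comm] at hm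
  | succ n ih =>
    suffices H : ∀ l ≤ h, ∀ m, u * m ∈ Q ⊔ Ideal.span (y '' Set.Iio l) * q ^ (n + 1) →
        m ∈ q ^ (n + 1) * (Q ⊔ q).colon {u} ⊔ Q.colon {u} by
      refine H h le_rfl m ?_
      rwa [← pow_succ']
    intro l
    induction l with
    | zero =>
      intro _ m hm
      refine Ideal.mem_sup_right (Submodule.mem_colon_singleton.mpr ?_)
      simpa [mul_comm m u] using hm
    | succ l ihl =>
      intro hl m hm
      rw [span_image_Iio_succ, Ideal.sup_mul, ← sup_assoc] at hm
      obtain ⟨a, ha, _, hz, ham⟩ := Submodule.mem_sup.mp hm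
      obtain ⟨b, hb, rfl⟩ := Ideal.mem_span_singleton_mul.mp hz
      have hyl : y l ∈ q := Ideal.subset_span ⟨l, hl, rfl⟩
      have h1 : y l * b ∈ (Q ⊔ Ideal.span {u}) ⊔ Ideal.span (y '' Set.Iio l) := by
        rw [show y l * b = u * m - a by rw [← ham]; ring]
        refine sub_mem (Ideal.mem_sup_left (Ideal.mem_sup_right
          (Ideal.mul_mem_right _ _ (Ideal.mem_span_singleton_self u)))) ?_
        have hle : Q ⊔ Ideal.span (y '' Set.Iio l) * q ^ (n + 1) ≤
            (Q ⊔ Ideal.span {u}) ⊔ Ideal.span (y '' Set.Iio l) :=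
          sup_le_sup le_sup_left Ideal.mul_le_left
        exact hle ha
      have h2 : b ∈ (Q ⊔ Ideal.span {u}) ⊔ q ^ (n + 1) := Ideal.mem_sup_right hb
      have hle : (Q ⊔ Ideal.span {u}) ⊔ q ^ (n + 1) ≤ (Q ⊔ Ideal.span {u}) ⊔ q :=
        sup_le_sup_left (Ideal.pow_le_self n.succ_ne_zero) _
      have h3 := mem_sup_mul_pow hy n (l := l) (by omega) h2
        (mem_sup_of_mul_mem_sup hy hl (hle h2) h1)
      rw [sup_right_comm] at h3
      obtain ⟨δ, hδ, _, hg, rfl⟩ := Submodule.mem_sup.mp h3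
      obtain ⟨g, rfl⟩ := Ideal.mem_span_singleton'.mp hg
      -- Here `b = δ + g * u`; the induction hypothesis applies to `g`, and `y l * g₁` is subtracted
      -- from `m` to reduce `l + 1` to `l`.
      have hδ' : δ ∈ Q ⊔ q ^ (n + 1) := by
        have hle : Ideal.span (y '' Set.Iio l) * q ^ n ≤ q ^ (n + 1) := by
          rw [pow_succ']
          exact Ideal.mul_mono_left
            (Ideal.span_mono (Set.image_mono (Set.Iio_subset_Iio (by omega))))
        exact sup_le_sup_left hle Q hδ
      have h4 : u * g ∈ Q ⊔ q ^ (n + 1) := by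
        have := sub_mem (Ideal.mem_sup_right hb : _ ∈ Q ⊔ q ^ (n + 1)) hδ'
        rwa [add_sub_cancel_left, mul_comm] at this
      obtain ⟨g₁, hg₁, g₂, hg₂, rfl⟩ := Submodule.mem_sup.mp (ih h4)
      have h5 : u * (m - y l * g₁) ∈ Q ⊔ Ideal.span (y '' Set.Iio l) * q ^ (n + 1) := by
        have e : u * (m - y l * g₁) = a + y l * δ + y l * (g₂ * u) := by
          rw [mul_sub, ← ham]; ring
        rw [e]
        refine add_mem (add_mem ha ?_) (Ideal.mem_sup_left (Ideal.mul_mem_left _ _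
          (Submodule.mem_colon_singleton.mp hg₂)))
        obtain ⟨ν, hν, δ', hδ₁, rfl⟩ := Submodule.mem_sup.mp hδ
        rw [mul_add]
        refine add_mem (Ideal.mem_sup_left (Ideal.mul_mem_left _ _ hν)) (Ideal.mem_sup_right ?_)
        have := Ideal.mul_mem_mul hδ₁ hyl
        rwa [mul_assoc, ← pow_succ, mul_comm δ'] at this
      have h6 : y l * g₁ ∈ q ^ (n + 1) * (Q ⊔ q).colon {u} := by
        rw [pow_succ', mul_assoc]
        exact Ideal.mul_mem_mul hyl hg₁
      have := add_mem (ihl (by omega) _ h5) (Ideal.mem_sup_left h6 :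
        _ ∈ q ^ (n + 1) * (Q ⊔ q).colon {u} ⊔ Q.colon {u})
      rwa [sub_add_cancel] at this

end Colon

end Macaulayfication

end

/-! ### Colon ideals of powers of parameters -/

section

open IsLocalRing

namespace Macaulayfication

section Stable

variable {A : Type*} [CommRing A] {d : ℕ} {x : Fin d → A}

/-- The ideal generated by the powers `x i ^ n i` with `i ∈ Λ`. -/
def powSpan (x : Fin d → A) (n : Fin d → ℕ) (Λ : Set (Fin d)) : Ideal A :=
  Ideal.span ((fun i => x i ^ n i) '' Λ)

lemma powSpan_congr {n n' : Fin d → ℕ} {Λ : Set (Fin d)} (h : ∀ i ∈ Λ, n i = n' i) :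
    powSpan x n Λ = powSpan x n' Λ := by
  unfold powSpan
  congr 1
  exact Set.image_congr fun i hi => by rw [h i hi]

lemma powSpan_union (n : Fin d → ℕ) (Λ Λ' : Set (Fin d)) :
    powSpan x n (Λ ∪ Λ') = powSpan x n Λ ⊔ powSpan x n Λ' := by
  rw [powSpan, Set.image_union, Ideal.span_union]
  rfl

lemma powSpan_of_eq_one {n : Fin d → ℕ} {Λ : Set (Fin d)} (h : ∀ i ∈ Λ, n i = 1) :
    powSpan x n Λ = Ideal.span (x '' Λ) := by
  unfold powSpan
  congr 1
  exact Set.image_congr fun i hi => by rw [h i hi, pow_one]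

/-- Multiplication by `x k` maps `Q : x u ^ e x k ^ f` into `Q`, for every `Q` generated by `𝔯` and
powers of elements `x i` with `i < k`, and every `u ≤ k` such that no power of `x u` is among the
chosen generators. The case `u = k` is included, and so is `e = 0` or `f = 0`. -/
def ColonStable (x : Fin d → A) (𝔯 : Ideal A) (k : Fin d) : Prop :=
  ∀ n : Fin d → ℕ, (∀ i, 0 < n i) → ∀ (Λ : Set (Fin d)) (u : Fin d), (∀ i ∈ Λ, i < k) → u ≤ k →
    u ∉ Λ → ∀ (e f : ℕ) (c : A), x u ^ e * (x k ^ f * c) ∈ 𝔯 ⊔ powSpan x n Λ →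
      x k * c ∈ 𝔯 ⊔ powSpan x n Λ

/-- If `x l m ∈ Q` for all `l` with `k < l < t`, where `Q` is generated by `𝔯` and powers of
elements of index less than `k`, then `m ∈ Q + (x (k+1), …, x (t-1))` implies `m ∈ Q`. The
generators are removed from the last one on. -/
lemma mem_of_mem_sup_span {𝔯 : Ideal A} {k : Fin d} {t : ℕ}
    (hstable : ∀ l : Fin d, k < l → (l : ℕ) < t → ColonStable x 𝔯 l) {n : Fin d → ℕ}
    (hn : ∀ i, 0 < n i) {Λ : Set (Fin d)} (hΛ : ∀ i ∈ Λ, i < k) {m : A}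
    (hm : ∀ l : Fin d, k < l → (l : ℕ) < t → x l * m ∈ 𝔯 ⊔ powSpan x n Λ)
    (h : m ∈ (𝔯 ⊔ powSpan x n Λ) ⊔ Ideal.span (x '' {j | k < j ∧ (j : ℕ) < t})) :
    m ∈ 𝔯 ⊔ powSpan x n Λ := by
  induction t with
  | zero => simpa using h
  | succ t ih =>
    refine ih (fun l h1 h2 => hstable l h1 (by omega)) (fun l h1 h2 => hm l h1 (by omega)) ?_
    by_cases ht : (k : ℕ) < t ∧ t < d
    · obtain ⟨hkt, htd⟩ := ht
      let l : Fin d := ⟨t, htd⟩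
      have hset : {j : Fin d | k < j ∧ (j : ℕ) < t + 1} =
          insert l {j : Fin d | k < j ∧ (j : ℕ) < t} := by
        ext j
        simp only [Set.mem_ofPred_eq, Set.mem_insert_iff, Fin.lt_def, Fin.ext_iff, l]
        omega
      let n' : Fin d → ℕ := fun j => if j < k then n j else 1
      have hQ : 𝔯 ⊔ powSpan x n' (Λ ∪ {j | k < j ∧ (j : ℕ) < t}) =
          (𝔯 ⊔ powSpan x n Λ) ⊔ Ideal.span (x '' {j | k < j ∧ (j : ℕ) < t}) := by
        rw [powSpan_union, sup_assoc]
        congr 2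
        · exact powSpan_congr fun i hi => if_pos (hΛ i hi)
        · exact powSpan_of_eq_one fun i hi => if_neg hi.1.not_gt
      rw [hset, Set.image_insert_eq, Ideal.span_insert, sup_comm (Ideal.span {x l}), ← sup_assoc,
        ← hQ] at h
      rw [← hQ]
      obtain ⟨a, ha, _, hz, ham⟩ := Submodule.mem_sup.mp h
      obtain ⟨b, rfl⟩ := Ideal.mem_span_singleton'.mp hz
      rw [← ham]
      refine add_mem ha ?_
      rw [mul_comm]
      refine hstable l hkt (Nat.lt_succ_self t) n' (fun i => ?_) _ l ?_ le_rfl ?_ 1 1 b ?_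
      · simp only [n']
        split_ifs
        exacts [hn i, one_pos]
      · rintro i (hi | hi)
        · exact (hΛ i hi).trans hkt
        · exact hi.2
      · rintro (hl | hl)
        · exact absurd (hΛ l hl) (not_lt_of_gt hkt)
        · exact absurd hl.2 (lt_irrefl t)
      · have h1 : x l * m ∈ 𝔯 ⊔ powSpan x n' (Λ ∪ {j | k < j ∧ (j : ℕ) < t}) := by
          rw [hQ]
          exact Ideal.mem_sup_left (hm l hkt (Nat.lt_succ_self t))
        have h2 := sub_mem h1 (Ideal.mul_mem_left _ (x l) ha)
        rw [← ham] at h2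
        convert h2 using 1
        ring
    · have hset : {j : Fin d | k < j ∧ (j : ℕ) < t + 1} = {j : Fin d | k < j ∧ (j : ℕ) < t} := by
        ext j
        simp only [Set.mem_ofPred_eq, Fin.lt_def]
        omega
      rwa [hset] at h

end Stable

variable {A : Type u} [CommRing A] [IsLocalRing A] {d : ℕ} {x : Fin d → A} {s : ℕ}

lemma IsSystemOfParameters.mem_maximalIdeal (hx : IsSystemOfParameters x) (i : Fin d) :
    x i ∈ maximalIdeal A := by
  rw [← hx.2]
  exact Ideal.le_radical (Ideal.subset_span ⟨i, rfl⟩)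

variable [IsNoetherianRing A]

/-- `smul_mem_of_mem_cohomologyAnnihilator` for powers of the members of a system of parameters,
some of which, with indices in `T`, act as zero on `M`. -/
lemma IsSystemOfParameters.smul_mem (hx : IsSystemOfParameters x) {M : Type u} [AddCommGroup M]
    [Module A M] [Module.Finite A M] {a : A} (ha : a ∈ cohomologyAnnihilator A M) {T : Set (Fin d)}
    (hT : ∀ r ∈ Ideal.span (x '' T), ∀ m : M, r • m = 0) {U : Finset (Fin d)}
    (hTU : T ∪ U = Set.univ)
    (hU : U.card ≤ moduleDim A M) {n : Fin d → ℕ} (hn : ∀ i, 0 < n i) {Λ : Set (Fin d)}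
    (hΛ : Λ ⊆ U) {u : Fin d} (hu : u ∈ U) (huΛ : u ∉ Λ) {e : ℕ} {m : M}
    (hm : x u ^ e • m ∈ powSpan x n Λ • (⊤ : Submodule A M)) :
    a • m ∈ powSpan x n Λ • (⊤ : Submodule A M) := by
  classical
  rcases Nat.eq_zero_or_pos e with rfl | he
  · rw [pow_zero, one_smul] at hm
    exact Submodule.smul_mem _ _ hm
  -- Changing the exponent at `u` to `e` does not affect the ideal, since `u ∉ Λ`.
  let n' := Function.update n u e
  have hn' (i) : 0 < n' i := by
    by_cases h : i = u
    · subst h; simpa [n'] using he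
    · simpa [n', h] using hn i
  have hQ : powSpan x n Λ = powSpan x n' Λ :=
    powSpan_congr fun i hi => by
      have : i ≠ u := fun h => huΛ (h ▸ hi)
      simp [n', this]
  rw [hQ] at hm ⊢
  have hΛ' : ((Set.toFinite Λ).toFinset : Set (Fin d)) = Λ := Set.Finite.coe_toFinset _
  have := smul_mem_of_mem_cohomologyAnnihilator ha hT (fun i => x i ^ n' i) U hU
    (fun i _ => Ideal.pow_mem_of_mem _ (hx.mem_maximalIdeal i) _ (hn' i)) ?_
    (Λ := (Set.toFinite Λ).toFinset) (fun i hi => hΛ (by simpa using hi)) hu (by simpa using huΛ)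
    (m := m) ?_
  · rwa [hΛ'] at this
  · rw [← hx.2, Ideal.radical_le_radical_iff, Ideal.span_le]
    rintro _ ⟨i, rfl⟩
    rcases (hTU ▸ Set.mem_univ i : i ∈ T ∪ U) with hi | hi
    · exact Ideal.le_radical (Ideal.mem_sup_left (Ideal.subset_span ⟨i, hi, rfl⟩))
    · exact ⟨n' i, Ideal.mem_sup_right (Ideal.subset_span ⟨i, hi, rfl⟩)⟩
  · rw [hΛ']
    simpa [n'] using! hm

lemma IsAdapted.mul_mem_of_le (hx : IsSystemOfParameters x) (hxs : IsAdapted s x) {k : Fin d}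
    (hk : s ≤ k) {n : Fin d → ℕ} (hn : ∀ i, 0 < n i) {Λ : Set (Fin d)} {u : Fin d} (hu : u ∉ Λ)
    {e : ℕ} {c : A} (hc : x u ^ e * c ∈ powSpan x n Λ) : x k * c ∈ powSpan x n Λ := by
  have hdim : d ≤ moduleDim A A := by
    rw [moduleDim, Module.supportDim_self_eq_ringKrullDim, hx.1]
    exact le_rfl
  have := hx.smul_mem (hxs.1 k hk) (T := ∅) (U := Finset.univ) (by simp) (by simp) (by simpa) hn
    (by simp) (Finset.mem_univ u) hu (m := c) (e := e)
  simp only [smul_eq_mul, Ideal.mul_top] at this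
  exact this hc

lemma IsAdapted.mul_mem_of_lt (hx : IsSystemOfParameters x) (hxs : IsAdapted s x) {k : Fin d}
    (hk : (k : ℕ) < s) {n : Fin d → ℕ} (hn : ∀ i, 0 < n i) {Λ : Set (Fin d)} (hΛ : ∀ i ∈ Λ, i ≤ k)
    {u : Fin d} (huk : u ≤ k) (hu : u ∉ Λ) {e : ℕ} {c : A}
    (hc : x u ^ e * c ∈ Ideal.span (x '' {j | k < j}) ⊔ powSpan x n Λ) :
    x k * c ∈ Ideal.span (x '' {j | k < j}) ⊔ powSpan x n Λ := by
  have hdim : (Finset.Iic k).card ≤ moduleDim A (A ⧸ Ideal.span (x '' {j | k < j})) := by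
    have := le_moduleDim_quotient_span hx.1 x hx.mem_maximalIdeal (Finset.Ioi k)
      (r := (Finset.Iic k).card) (by simp; omega)
    rwa [Finset.coe_Ioi] at this
  have := hx.smul_mem (hxs.2 k hk) (T := {j | k < j}) (U := Finset.Iic k) ?_ ?_ hdim hn
    (Λ := Λ) (fun i hi => by simpa using hΛ i hi) (u := u) (by simpa) hu (e := e)
    (m := Submodule.Quotient.mk c)
  · rw [← Submodule.Quotient.mk_smul, ← Submodule.Quotient.mk_smul, mk_mem_smul_top_iff,
      mk_mem_smul_top_iff] at this
    exact this hc
  · intro r hr m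
    obtain ⟨m, rfl⟩ := Submodule.Quotient.mk_surjective _ m
    rw [← Submodule.Quotient.mk_smul, Submodule.Quotient.mk_eq_zero]
    exact Ideal.mul_mem_right _ _ hr
  · ext j
    simpa using lt_or_ge k j

lemma IsAdapted.mul_mem_of_mul_pow_mem (hx : IsSystemOfParameters x) (hxs : IsAdapted s x)
    {k : Fin d} (hk : s ≤ k) {n : Fin d → ℕ} (hn : ∀ i, 0 < n i) {Λ : Set (Fin d)} {u : Fin d}
    (hu : u ∉ Λ) (hkΛ : k ∉ Λ) {e f : ℕ} {c : A}
    (hc : x u ^ e * (x k ^ f * c) ∈ powSpan x n Λ) : x k * c ∈ powSpan x n Λ := by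
  have h1 := hxs.mul_mem_of_le hx hk hn hu hc
  rw [← mul_assoc, ← pow_succ'] at h1
  exact hxs.mul_mem_of_le hx hk hn hkΛ h1

/-- For `k < s`, the membership holds modulo `(x (k+1), …, x (d-1))`, because
`x k ∈ cohomologyAnnihilator A (A ⧸ (x (k+1), …, x (d-1)))`; the parameters of index greater than
`k` are then removed by `mem_of_mem_sup_span` and descending induction on `k`. -/
lemma IsAdapted.colonStable (hx : IsSystemOfParameters x) (hxs : IsAdapted s x) {t : ℕ}
    (hbase : ∀ k : Fin d, s ≤ k → (k : ℕ) < t →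
      ColonStable x (Ideal.span (x '' {j | t ≤ (j : ℕ)})) k) (k : Fin d) (hk : (k : ℕ) < t) :
    ColonStable x (Ideal.span (x '' {j | t ≤ (j : ℕ)})) k := by
  set 𝔯 := Ideal.span (x '' {j : Fin d | t ≤ (j : ℕ)})
  induction hr : d - (k : ℕ) using Nat.strong_induction_on generalizing k with
  | _ r ih =>
  rcases le_or_gt s k with hsk | hks
  · exact hbase k hsk hk
  have hstable (l : Fin d) (hkl : k < l) (hlt : (l : ℕ) < t) : ColonStable x 𝔯 l :=
    ih (d - l) (by have : (k : ℕ) < l := hkl; omega) l hlt rfl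
  intro n hn Λ u hΛ huk hu e f c hc
  have hle1 : 𝔯 ⊔ powSpan x n Λ ≤ Ideal.span (x '' {j | k < j}) ⊔ powSpan x n Λ := by
    refine sup_le_sup_right (Ideal.span_mono (Set.image_mono fun j hj => ?_)) _
    exact lt_of_lt_of_le hk hj
  have hle2 : Ideal.span (x '' {j | k < j}) ⊔ powSpan x n Λ ≤
      (𝔯 ⊔ powSpan x n Λ) ⊔ Ideal.span (x '' {j | k < j ∧ (j : ℕ) < t}) := by
    refine sup_le ?_ (le_sup_right.trans le_sup_left)
    rw [Ideal.span_le]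
    rintro _ ⟨j, hj, rfl⟩
    by_cases hjt : (j : ℕ) < t
    · exact Ideal.mem_sup_right (Ideal.subset_span ⟨j, ⟨hj, hjt⟩, rfl⟩)
    · exact Ideal.mem_sup_left (Ideal.mem_sup_left (Ideal.subset_span ⟨j, not_lt.mp hjt, rfl⟩))
  have hkΛ : k ∉ Λ := fun h => lt_irrefl _ (hΛ k h)
  refine mem_of_mem_sup_span hstable hn hΛ (fun l hkl hlt => ?_) (hle2 ?_)
  · have hlΛ (i) (hi : i ∈ Λ) : i < l := (hΛ i hi).trans hkl
    have h1 := hstable l hkl hlt n hn Λ u hlΛ (huk.trans hkl.le) hu e 0 (x k ^ f * c)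
      (by simpa using hc)
    rw [mul_left_comm] at h1
    have h2 := hstable l hkl hlt n hn Λ k hlΛ hkl.le hkΛ f 1 c (by simpa using h1)
    rw [mul_left_comm]
    exact Ideal.mul_mem_left _ _ h2
  · have h1 := hxs.mul_mem_of_lt hx hks hn (fun i hi => (hΛ i hi).le) huk hu (hle1 hc)
    rw [← mul_assoc, ← pow_succ'] at h1
    exact hxs.mul_mem_of_lt hx hks hn (fun i hi => (hΛ i hi).le) le_rfl hkΛ h1

lemma IsAdapted.colonStable_bot (hx : IsSystemOfParameters x) (hxs : IsAdapted s x) (k : Fin d) :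
    ColonStable x ⊥ k := by
  have hbot : Ideal.span (x '' {j | d ≤ (j : ℕ)}) = ⊥ := by
    have : {j : Fin d | d ≤ (j : ℕ)} = ∅ := by ext j; simp
    rw [this]; simp
  rw [← hbot]
  refine hxs.colonStable hx (fun k hk _ => ?_) k k.2
  rw [hbot]
  intro n hn Λ u hΛ _ hu e f c hc
  rw [bot_sup_eq] at hc ⊢
  exact hxs.mul_mem_of_mul_pow_mem hx hk hn hu (fun h => lt_irrefl _ (hΛ k h)) hc

lemma IsAdapted.colonStable_span (hx : IsSystemOfParameters x) (hxs : IsAdapted s x) {k : Fin d}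
    (hk : (k : ℕ) < s) : ColonStable x (Ideal.span (x '' {j | s ≤ (j : ℕ)})) k :=
  hxs.colonStable hx (fun _ h1 h2 => absurd h1 (not_le_of_gt h2)) k hk

end Macaulayfication

end

/-! ### The d-sequence properties -/

section

namespace Macaulayfication

/-- The elements `x s, x (s+1), …` of a finite sequence, indexed by `ℕ` from `0` and extended by
zero. -/
def tailSeq {A : Type*} [CommRing A] {d : ℕ} (x : Fin d → A) (s : ℕ) (j : ℕ) : A :=
  if h : s + j < d then x ⟨s + j, h⟩ else 0

lemma span_tailSeq {A : Type*} [CommRing A] {d : ℕ} (x : Fin d → A) (s l : ℕ) :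
    Ideal.span (tailSeq x s '' Set.Iio l) =
      Ideal.span (x '' {j | s ≤ (j : ℕ) ∧ (j : ℕ) < s + l}) := by
  apply le_antisymm <;> rw [Ideal.span_le]
  · rintro _ ⟨j, hj, rfl⟩
    by_cases h : s + j < d
    · rw [tailSeq, dif_pos h]
      exact Ideal.subset_span ⟨⟨s + j, h⟩, ⟨Nat.le_add_right _ _, Nat.add_lt_add_left hj s⟩, rfl⟩
    · rw [tailSeq, dif_neg h]
      exact zero_mem _
  · rintro _ ⟨j, ⟨h1, h2⟩, rfl⟩
    refine Ideal.subset_span ⟨j - s, ?_, ?_⟩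
    · rw [Set.mem_Iio]; omega
    · have h : s + ((j : ℕ) - s) = j := by omega
      simp [tailSeq, h]

variable {A : Type u} [CommRing A] [IsLocalRing A] [IsNoetherianRing A] {d : ℕ} {x : Fin d → A}
  {s : ℕ}

lemma IsAdapted.isDSequence (hx : IsSystemOfParameters x) (hxs : IsAdapted s x) {n : Fin d → ℕ}
    (hn : ∀ i, 0 < n i) {σ : Equiv.Perm (Fin d)} (hσ : ∀ i : Fin d, (i : ℕ) < s → σ i = i) :
    IsDSequence A fun i => x (σ i) ^ n i := by
  intro i j hij
  let n' : Fin d → ℕ := n ∘ σ.symm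
  have hn' (i) : 0 < n' i := hn _
  have hQ : Ideal.span ((fun i => x (σ i) ^ n i) '' {k | k < i}) =
      powSpan x n' (σ '' {k | k < i}) := by
    rw [powSpan, Set.image_image]
    simp [n']
  have hnot (k : Fin d) (hik : i ≤ k) : σ k ∉ σ '' {k | k < i} := by
    rintro ⟨l, hl, hlk⟩
    exact absurd (σ.injective hlk ▸ hl : k < i) hik.not_gt
  rw [smul_eq_mul, Ideal.mul_top, hQ]
  ext c
  simp only [Submodule.mem_comap, LinearMap.lsmul_apply, smul_eq_mul]
  refine ⟨fun hc => ?_, fun hc => ?_⟩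
  · suffices h : x (σ j) * c ∈ powSpan x n' (σ '' {k | k < i}) by
      obtain ⟨r, hr⟩ := dvd_pow_self (x (σ j)) (hn j).ne'
      rw [hr, mul_comm (x (σ j)), mul_assoc]
      exact Ideal.mul_mem_left _ _ h
    rw [mul_assoc] at hc
    by_cases hj : s ≤ σ j
    · exact hxs.mul_mem_of_mul_pow_mem hx hj hn' (hnot i le_rfl) (hnot j hij) hc
    -- If `σ j < s`, then `σ` fixes `σ j`, so `σ j = j`, and `σ` is the identity up to `j`.
    · have hj' : σ j = j := σ.injective (hσ _ (not_le.mp hj))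
      rw [hj'] at hj
      have hfix (k : Fin d) (hk : k ≤ j) : σ k = k :=
        hσ k (lt_of_le_of_lt (Fin.le_def.mp hk) (not_le.mp hj))
      have himg : σ '' {k | k < i} = {k | k < i} := by
        ext k
        constructor
        · rintro ⟨l, hl, rfl⟩
          rwa [hfix l (hl.le.trans hij)]
        · exact fun hk => ⟨k, hk, hfix k (le_trans (le_of_lt hk) hij)⟩
      rw [himg, hj'] at hc ⊢
      rw [hfix i hij] at hc
      have := hxs.colonStable_bot hx j n' hn' {k | k < i} i (fun k hk => lt_of_lt_of_le hk hij)
        hij (lt_irrefl i) (n i) (n j) c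
      rw [bot_sup_eq] at this
      exact this hc
  · rw [mul_assoc]
    exact Ideal.mul_mem_left _ _ hc

/-- The elements `x s, x (s+1), …` are a d-sequence modulo powers of elements of smaller index. -/
lemma IsAdapted.mul_tailSeq_mem (hx : IsSystemOfParameters x) (hxs : IsAdapted s x) {n : Fin d → ℕ}
    (hn : ∀ i, 0 < n i) {Λ : Set (Fin d)} (hΛ : ∀ i ∈ Λ, (i : ℕ) < s) {u : Fin d}
    (hu : (u : ℕ) < s) (huΛ : u ∉ Λ) {e : ℕ} (he : 0 < e) {l k : ℕ} (hlk : l ≤ k)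
    (hk : k < d - s) {c : A}
    (hc : tailSeq x s l * (tailSeq x s k * c) ∈
      (powSpan x n Λ ⊔ Ideal.span {x u ^ e}) ⊔ Ideal.span (tailSeq x s '' Set.Iio l)) :
    tailSeq x s k * c ∈
      (powSpan x n Λ ⊔ Ideal.span {x u ^ e}) ⊔ Ideal.span (tailSeq x s '' Set.Iio l) := by
  let n' : Fin d → ℕ := fun j => if s ≤ (j : ℕ) then 1 else if j = u then e else n j
  have hn' (i) : 0 < n' i := by
    simp only [n']
    split_ifs
    exacts [one_pos, he, hn i]
  have hQ : (powSpan x n Λ ⊔ Ideal.span {x u ^ e}) ⊔ Ideal.span (tailSeq x s '' Set.Iio l) =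
      powSpan x n' ((Λ ∪ {u}) ∪ {j | s ≤ (j : ℕ) ∧ (j : ℕ) < s + l}) := by
    rw [powSpan_union, powSpan_union, span_tailSeq]
    congr 1
    · congr 1
      · refine powSpan_congr fun i hi => ?_
        have hiu : i ≠ u := fun h => huΛ (h ▸ hi)
        simp [n', (hΛ i hi).not_ge, hiu]
      · simp [powSpan, n', hu.not_ge]
    · exact (powSpan_of_eq_one fun i hi => if_pos hi.1).symm
  rw [hQ] at hc ⊢
  have hnot (j : ℕ) (hlj : l ≤ j) (hj : s + j < d) :
      (⟨s + j, hj⟩ : Fin d) ∉ (Λ ∪ {u}) ∪ {j : Fin d | s ≤ (j : ℕ) ∧ (j : ℕ) < s + l} := by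
    rintro ((h | h) | h)
    · have := hΛ _ h
      simp at this
    · have : s + j = u := congrArg Fin.val h
      omega
    · have := h.2
      simp at this
      omega
  have hk' : s + k < d := by omega
  have hl' : s + l < d := by omega
  have htk : tailSeq x s k = x ⟨s + k, hk'⟩ := dif_pos hk'
  have htl : tailSeq x s l = x ⟨s + l, hl'⟩ := dif_pos hl'
  rw [htk] at hc ⊢
  rw [htl] at hc
  exact hxs.mul_mem_of_mul_pow_mem hx (Nat.le_add_right s k) hn' (hnot l le_rfl hl')
    (hnot k hlk hk') (e := 1) (f := 1) (by simpa using hc)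

/-- Modulo `Q + 𝔮 ^ (m+1)`, where `𝔮` is generated by the `x i` with `i ≥ s` and `Q` by powers of
elements of index less than `k`, everything killed by a power of `x u` is killed by `x k`. -/
lemma IsAdapted.mul_mem_sup_pow (hx : IsSystemOfParameters x) (hxs : IsAdapted s x) {n : Fin d → ℕ}
    (hn : ∀ i, 0 < n i) {k : Fin d} (hk : (k : ℕ) < s) {Λ : Set (Fin d)} (hΛ : ∀ i ∈ Λ, i < k)
    {u : Fin d} (huk : u ≤ k) (huΛ : u ∉ Λ) {e : ℕ} (he : 0 < e) {m : ℕ} {c : A}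
    (hc : x u ^ e * c ∈ powSpan x n Λ ⊔ Ideal.span (x '' {j | s ≤ (j : ℕ)}) ^ (m + 1)) :
    x k * c ∈ powSpan x n Λ ⊔ Ideal.span (x '' {j | s ≤ (j : ℕ)}) ^ (m + 1) := by
  have hq : Ideal.span (x '' {j | s ≤ (j : ℕ)}) =
      Ideal.span (tailSeq x s '' Set.Iio (d - s)) := by
    rw [span_tailSeq]
    congr 2
    ext j
    have := j.2
    simp only [Set.mem_ofPred_eq]
    omega
  have hus : (u : ℕ) < s := lt_of_le_of_lt (Fin.le_def.mp huk) hk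
  rw [hq] at hc
  have key := mem_of_mul_mem_sup_pow (Q := powSpan x n Λ)
    (fun l j hlj hj c h => hxs.mul_tailSeq_mem hx hn
      (fun i hi => (Fin.lt_def.mp (hΛ i hi)).trans hk) hus huΛ he hlj hj h) m hc
  rw [← hq] at key
  obtain ⟨a, ha, b, hb, rfl⟩ := Submodule.mem_sup.mp key
  rw [mul_add]
  refine add_mem ?_ (Ideal.mem_sup_left ?_)
  · refine Submodule.mul_induction_on ha (fun p hp r hr => ?_) (fun p r hp hr => ?_)
    · rw [Submodule.mem_colon_singleton, smul_eq_mul, mul_comm r, sup_comm] at hr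
      have h := hxs.colonStable_span hx hk n hn Λ u hΛ huk huΛ e 0 r (by simpa using hr)
      have h1 := Ideal.mul_mem_mul hp h
      rw [Ideal.mul_sup, ← pow_succ] at h1
      rw [mul_left_comm, sup_comm]
      have hle := sup_le_sup_left
        (Ideal.mul_le_right (I := Ideal.span (x '' {j | s ≤ (j : ℕ)}) ^ m) (J := powSpan x n Λ))
        (Ideal.span (x '' {j | s ≤ (j : ℕ)}) ^ (m + 1))
      exact hle h1
    · rw [mul_add]
      exact add_mem hp hr
  · rw [Submodule.mem_colon_singleton, smul_eq_mul, mul_comm b] at hb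
    have h := hxs.colonStable_bot hx k n hn Λ u hΛ huk huΛ e 0 b
    rw [bot_sup_eq] at h
    exact h (by simpa using hb)

lemma IsAdapted.isDSequence_quotient_pow (hx : IsSystemOfParameters x) (hxs : IsAdapted s x)
    (hs : s ≤ d) {n : Fin s → ℕ} (hn : ∀ i, 0 < n i) (m : ℕ) :
    IsDSequence (A ⧸ Ideal.span (x '' {i : Fin d | s ≤ (i : ℕ)}) ^ (m + 1))
      (fun i : Fin s => x (Fin.castLE hs i) ^ n i) := by
  intro i j hij
  let n' : Fin d → ℕ := fun k => if h : (k : ℕ) < s then n ⟨k, h⟩ else 1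
  have hn' (i) : 0 < n' i := by
    simp only [n']
    split_ifs
    exacts [hn _, one_pos]
  have hQ : Ideal.span ((fun i => x (Fin.castLE hs i) ^ n i) '' {k | k < i}) =
      powSpan x n' {k | k < Fin.castLE hs i} := by
    unfold powSpan
    congr 1
    ext a
    constructor
    · rintro ⟨k, hk, rfl⟩
      exact ⟨Fin.castLE hs k, hk, by simp [n']⟩
    · rintro ⟨k, hk, rfl⟩
      have hks : (k : ℕ) < s := (Fin.lt_def.mp hk).trans i.2
      exact ⟨⟨k, hks⟩, hk, by simp [n', hks]⟩
  rw [hQ]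
  ext c
  obtain ⟨c, rfl⟩ := Submodule.Quotient.mk_surjective _ c
  simp only [Submodule.mem_comap, LinearMap.lsmul_apply]
  rw [← Submodule.Quotient.mk_smul, ← Submodule.Quotient.mk_smul, mk_mem_smul_top_iff,
    mk_mem_smul_top_iff, smul_eq_mul, smul_eq_mul, mul_assoc]
  refine ⟨fun hc => ?_, Ideal.mul_mem_left _ _⟩
  rw [sup_comm] at hc ⊢
  have hΛ (k : Fin d) (hk : k ∈ {k | k < Fin.castLE hs i}) : k < Fin.castLE hs j :=
    lt_of_lt_of_le hk hij
  have hjs : ((Fin.castLE hs j : Fin d) : ℕ) < s := j.2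
  have h1 := hxs.mul_mem_sup_pow hx hn' hjs hΛ (u := Fin.castLE hs i) hij (by simp) (hn i) hc
  rw [← mul_assoc, ← pow_succ'] at h1
  have h2 := hxs.mul_mem_sup_pow hx hn' hjs hΛ le_rfl (fun h => lt_irrefl _ (hΛ _ h))
    (Nat.succ_pos _) h1
  obtain ⟨r, hr⟩ := dvd_pow_self (x (Fin.castLE hs j)) (hn j).ne'
  rw [hr, mul_comm (x (Fin.castLE hs j)), mul_assoc]
  exact Ideal.mul_mem_left _ _ h2

end Macaulayfication

end

theorem theorem4p2 {A : Type*} [CommRing A] [IsLocalRing A] [IsNoetherianRing A]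
    {d : ℕ} (x : Fin d → A) (hx : Macaulayfication.IsSystemOfParameters x)
    (s : ℕ) (hs : s ≤ d) (hxs : Macaulayfication.IsAdapted s x) :
    (∀ n : Fin d → ℕ, (∀ i, 0 < n i) →
      ∀ σ : Equiv.Perm (Fin d), (∀ i : Fin d, (i : ℕ) < s → σ i = i) →
        Macaulayfication.IsDSequence A (fun i : Fin d => x (σ i) ^ n i)) ∧
    (0 < s →
      ∀ n : Fin s → ℕ, (∀ i, 0 < n i) → ∀ m : ℕ, 0 < m →
        Macaulayfication.IsDSequence
          (A ⧸ (Ideal.span (x '' {i : Fin d | s ≤ (i : ℕ)})) ^ m)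
          (fun i : Fin s => x (Fin.castLE hs i) ^ n i)) := by
  refine ⟨fun n hn σ hσ => hxs.isDSequence hx hn hσ, fun _ n hn m hm => ?_⟩
  obtain ⟨m, rfl⟩ := Nat.exists_eq_succ_of_ne_zero hm.ne'
  exact hxs.isDSequence_quotient_pow hx hs hn m
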